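/- Let $d\ge 1$, let $\mu$ be a compactly supported finite Borel measure on $\mathbb{R}^{2d}=\mathbb{R}^d\times\mathbb{R}^d$ with Fourier transform $\hat\mu(\xi,\eta)=\int e^{-2\pi i(y\cdot\xi+z\cdot\eta)}\,d\mu(y,z)$, and let $E\subset[1,2]$ be a nonempty set with upper Minkowski dimension $$\beta=\limsup_{\delta\to0^+}\frac{\log N(E,\delta)}{\log(1/\delta)},$$ where $N(E,\delta)$ is the least number of closed intervals of length $\delta$ that cover $E$. Suppose that $\hat\mu$ is $a$-admissible, that is, $a>\frac d2$ and $|\hat\mu(\xi,\eta)|\le C_0(1+|\xi|+|\eta|)^{-a}$ for some constant $C_0$ and all $\xi,\eta\in\mathbb{R}^d$, and that $2a>d+\beta$. For $f,g\in C_0^\infty(\mathbb{R}^d)$ put $$\mathcal{A}_{\hat\mu,E}(f,g)(x)=\sup_{t\in E}\Big|\int_{\mathbb{R}^{2d}}\hat f(\xi)\hat g(\eta)\hat\mu(t\xi,t\eta)e^{2\pi i x\cdot(\xi+\eta)}\,d\xi\,d\eta\Big| ,$$ and for general $f,g$ put $$\mathcal{A}_{\hat\mu,E}(f,g)(x)=\sup_{t\in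 E}\Big|\int f(x-ty)g(x-tz)\,d\mu(y,z)\Big| .$$ We say that $\mathcal{A}_{\hat\mu,E}$ maps $L^p\times L^q\to L^r$ if there is a constant $C<\infty$ (which may depend on $d,\mu,E,p,q,r$) such that $\mathcal{A}_{\hat\mu,E}(f,g)\in L^r(\mathbb{R}^d)$ and $\|\mathcal{A}_{\hat\mu,E}(f,g)\|_{L^r}\le C\|f\|_{L^p}\|g\|_{L^q}$, both for all $f,g\in C_0^\infty(\mathbb{R}^d)$ with the first formula and for all $f\in L^p(\mathbb{R}^d)$, $g\in L^q(\mathbb{R}^d)$ with the second formula, where in the latter case, for almost every $x$, the integrals converge absolutely for all $t\in E$. Let $r_H=r_H(p,q)$ be given by $\frac1{r_H}=\frac1p+\frac1q$. (i) If $a\le d+\frac\beta2$, then $\mathcal{A}_{\hat\mu,E}$ maps $L^p\times L^q\to L^r$ whenever $\frac{2d}{2a-\beta}<p,q\le2$, $\frac1p+\frac1q<\frac12+\frac{2a-\beta}{2d}$ and $r_H(p,q)\le r\le2$. (ii) If $a>d+\frac\beta2$, then $\mathcal{A}_{\hat\mu,E}$ maps $L^p\times L^q\to L^r$ whenever $1<p,q\le2$,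 $\frac1p+\frac1q<\frac32$ and $r_H(p,q)\le r\le2$. -/

import Mathlib

open MeasureTheory Filter Topology
open scoped ENNReal NNReal ContDiff FourierTransform RealInnerProductSpace

noncomputable section

namespace BilinearMaximal

/-- `ℝ^d` with the Euclidean norm and inner product. A point of `ℝ^{2d}` is a pair of points of
`ℝ^d`; Lebesgue measure on `ℝ^{2d}` is the product measure. -/
abbrev Space (d : ℕ) : Type := EuclideanSpace ℝ (Fin d)

/-- `N(E, δ)`: the least number of closed intervals of length `δ` that cover `E`
(meant for bounded `E` and `δ > 0`, where finite covers exist). -/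
def coveringNumber (E : Set ℝ) (δ : ℝ) : ℕ :=
  sInf {n : ℕ | ∃ s : Finset ℝ, s.card = n ∧ E ⊆ ⋃ c ∈ s, Set.Icc c (c + δ)}

/-- The upper Minkowski dimension, the limsup of `log N(E, δ) / log (1 / δ)` as `δ → 0+`, taken in
the extended reals so that no boundedness is presupposed. -/
def upperMinkowskiDim (E : Set ℝ) : EReal :=
  limsup (fun δ : ℝ => ((Real.log (coveringNumber E δ) / Real.log (1 / δ) : ℝ) : EReal))
    (𝓝[>] (0 : ℝ))

variable {d : ℕ}

/-- The Fourier transform `μ̂(ξ, η) = ∫ exp (-2πi (y·ξ + z·η)) dμ(y, z)` of a measure on `ℝ^{2d}`. -/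
def fourierMeasure (μ : Measure (Space d × Space d)) (ζ : Space d × Space d) : ℂ :=
  ∫ w : Space d × Space d,
    Complex.exp (((-2 * Real.pi * (⟪w.1, ζ.1⟫ + ⟪w.2, ζ.2⟫) : ℝ) : ℂ) * Complex.I) ∂μ

/-- `m` has `a`-admissible decay (of order `0`): `a > d / 2` and
`|m(ξ, η)| ≤ C (1 + |ξ| + |η|)^{-a}` for some constant `C`. -/
def IsAdmissible (a : ℝ) (m : Space d × Space d → ℂ) : Prop :=
  (d : ℝ) / 2 < a ∧
    ∃ C : ℝ, ∀ ξ η : Space d, ‖m (ξ, η)‖ ≤ C * (1 + ‖ξ‖ + ‖η‖) ^ (-a)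

/-- `μ` is compactly supported. -/
def CompactlySupported (μ : Measure (Space d × Space d)) : Prop :=
  ∃ K : Set (Space d × Space d), IsCompact K ∧ μ Kᶜ = 0

/-- The class `C_0^∞(ℝ^d)` of smooth compactly supported complex functions. -/
def IsTestFunction (f : Space d → ℂ) : Prop :=
  ContDiff ℝ ∞ f ∧ HasCompactSupport f

/-- The bilinear multiplier operator
`T_m(f, g)(x) = ∫ f̂(ξ) ĝ(η) m(ξ, η) exp (2πi x·(ξ + η)) dξ dη`. -/
def bilinearMultiplier (m : Space d × Space d → ℂ) (f g : Space d → ℂ) (x : Space d) : ℂ :=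
  ∫ ζ : Space d × Space d, 𝓕 f ζ.1 * 𝓕 g ζ.2 * m ζ *
    Complex.exp (((2 * Real.pi * ⟪x, ζ.1 + ζ.2⟫ : ℝ) : ℂ) * Complex.I)

/-- The single-scale maximal operator `A_{m,E}(f, g)(x) = sup_{t ∈ E} |T_{m_t}(f, g)(x)|`, where
`m_t(ξ, η) = m(tξ, tη)`. -/
def maximalMultiplier (m : Space d × Space d → ℂ) (E : Set ℝ) (f g : Space d → ℂ)
    (x : Space d) : ℝ≥0∞ :=
  ⨆ t ∈ E, ‖bilinearMultiplier (fun ζ => m (t • ζ.1, t • ζ.2)) f g x‖ₑ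

/-- The average `∫ f(x - ty) g(x - tz) dμ(y, z)`, the form that `T_{m_t}(f, g)(x)` takes for
`m = μ̂`. -/
def bilinearAverage (μ : Measure (Space d × Space d)) (t : ℝ) (f g : Space d → ℂ)
    (x : Space d) : ℂ :=
  ∫ w : Space d × Space d, f (x - t • w.1) * g (x - t • w.2) ∂μ

/-- The maximal average `sup_{t ∈ E} |∫ f(x - ty) g(x - tz) dμ(y, z)|`: the operator `A_{μ̂,E}` for
functions `f`, `g` that need not be smooth. -/
def maximalAverage (μ : Measure (Space d × Space d)) (E : Set ℝ) (f g : Space d → ℂ)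
    (x : Space d) : ℝ≥0∞ :=
  ⨆ t ∈ E, ‖bilinearAverage μ t f g x‖ₑ

/-- `A_{μ̂,E} : L^p × L^q → L^r` is bounded, with one constant for both of the following.
For smooth compactly supported `f`, `g`, the operator given by the Fourier multiplier `μ̂` satisfies
`‖A_{μ̂,E}(f, g)‖_r ≤ C ‖f‖_p ‖g‖_q`. For arbitrary `f ∈ L^p`, `g ∈ L^q` (and any
representatives), at almost every `x` the averages over all `t ∈ E` converge absolutely, and their
supremum is a (measurable) function in `L^r` that satisfies the same bound. -/
def IsBoundedMaximal (μ : Measure (Space d × Space d)) (E : Set ℝ) (p q r : ℝ) : Prop :=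
  ∃ C : ℝ≥0,
    (∀ f g : Space d → ℂ, IsTestFunction f → IsTestFunction g →
      MemLp (maximalMultiplier (fourierMeasure μ) E f g) (ENNReal.ofReal r) volume ∧
      eLpNorm (maximalMultiplier (fourierMeasure μ) E f g) (ENNReal.ofReal r) volume ≤
        C * eLpNorm f (ENNReal.ofReal p) volume * eLpNorm g (ENNReal.ofReal q) volume) ∧
    (∀ f g : Space d → ℂ, MemLp f (ENNReal.ofReal p) volume → MemLp g (ENNReal.ofReal q) volume →
      (∀ᵐ x : Space d, ∀ t ∈ E,
        Integrable (fun w : Space d × Space d => f (x - t • w.1) * g (x - t • w.2)) μ) ∧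
      MemLp (maximalAverage μ E f g) (ENNReal.ofReal r) volume ∧
      eLpNorm (maximalAverage μ E f g) (ENNReal.ofReal r) volume ≤
        C * eLpNorm f (ENNReal.ofReal p) volume * eLpNorm g (ENNReal.ofReal q) volume)

end BilinearMaximal

end

open MeasureTheory Filter Topology
open scoped ENNReal NNReal ContDiff FourierTransform RealInnerProductSpace

noncomputable section

/-! Both parts follow from one statement, `isBoundedMaximal_of_admissible`: for `1 ≤ p, q ≤ 2` the
only real condition is `1/p + 1/q < 1/2 + (2a - β)/(2d)`.

The core is an `L^p × L^q → L^2` bound for test functions, proved one dyadic frequency shell `|ζ| ~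
R = 2^j` at a time, with `δ = 1/R`. At a fixed time, the phase depends only on `ξ + η`; Plancherel
in that variable and Cauchy-Schwarz in `ξ` over a ball of radius `R` bound the squared `L^2` norm by
`R^d · sup |μ̂|^2` times the squared `L^2(B_R)` norms of `f̂` and `ĝ`
(`lintegral_enorm_sumFourier_sq_le`). Those norms cost `R^{d(2/p - 1)}` and `R^{d(2/q - 1)}`
(`lintegral_ball_enorm_fourier_sq_le`), and admissibility gives `sup |μ̂|^2 ≲ R^{-2a}`. Since `μ`
has compact support, `t ↦ μ̂(tζ)` is band-limited at frequency `O(R)`, so its values on an interval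
of length `δ` are weighted averages over times near that interval (`exists_reproducing_kernel`). A
supremum over such an interval thus costs only a constant, with no decay of derivatives of `μ̂`
required, and the supremum over `E` costs `N(E, δ) ≲ R^{β + ε}`. The total exponent `β + ε - 2a - d
+ 2d(1/p + 1/q)` is negative for small `ε`, so the shells sum geometrically.

Target exponents `r < 2` come from locality: as `t ≤ 2` and `μ` is compactly supported, the operator
on a unit cube sees only boundedly many neighbouring cubes. Hölder on each cube lowers `2` to `r`,
and the cubes sum because `r/p + r/q ≥ 1`.

For general `f, g` the difficulty is the supremum over a possibly uncountable `E` of functions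
defined almost everywhere. It is handled by `posMax`, the maximal average of nonnegative functions:
semicontinuous majorants of `|f|` and `|g|` yield a measurable majorant with the right norm
(`HasPosMaxBound`). This single bound gives absolute convergence, independence of representatives,
measurability by approximation, and the norm inequality. -/

namespace BilinearMaximal

/-! ### Plancherel's identity on `L^1 ∩ L^2` -/

section Plancherel

variable {V : Type*} [NormedAddCommGroup V] [InnerProductSpace ℝ V] [FiniteDimensional ℝ V]
  [MeasurableSpace V] [BorelSpace V]

/-- The self-adjointness of the Fourier transform on `L^1`. -/
theorem integral_fourier_mul_eq {f g : V → ℂ} (hf : Integrable f) (hg : Integrable g) :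
    ∫ ξ, 𝓕 f ξ * g ξ = ∫ x, f x * 𝓕 g x := by
  have h := VectorFourier.integral_fourierIntegral_smul_eq_flip (μ := volume) (ν := volume)
    (L := innerₗ V) Real.continuous_fourierChar continuous_inner hf hg
  simp only [flip_innerₗ, smul_eq_mul] at h
  exact h

theorem continuous_fourier {f : V → ℂ} (hf : Integrable f) : Continuous (𝓕 f) :=
  VectorFourier.fourierIntegral_continuous Real.continuous_fourierChar
    (by exact continuous_inner) hf

theorem norm_fourier_le (f : V → ℂ) (ξ : V) : ‖𝓕 f ξ‖ ≤ ∫ x, ‖f x‖ :=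
  VectorFourier.norm_fourierIntegral_le_integral_norm _ _ _ _ _

/-- On `L^1 ∩ L^2` the `L^2` Fourier transform is given by the Fourier integral. -/
theorem fourier_toLp_ae_eq {f : V → ℂ} (hf : Integrable f) (hf2 : MemLp f 2) :
    (𝓕 (hf2.toLp f) : Lp (α := V) ℂ 2) =ᵐ[volume] 𝓕 f := by
  set F : Lp ℂ 2 (volume : Measure V) := 𝓕 (hf2.toLp f) with hF
  have hFloc : LocallyIntegrable F := (Lp.memLp F).locallyIntegrable (by norm_num)
  -- The two candidates agree as distributions: the `L^2` transform moves onto the test function by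
  -- definition, the Fourier integral by self-adjointness.
  refine ae_eq_of_integral_contDiff_smul_eq hFloc
    (continuous_fourier hf).locallyIntegrable fun g hg hgc => ?_
  have hgc' : HasCompactSupport (fun x => (g x : ℂ)) := hgc.comp_left (g := Complex.ofReal) rfl
  have hg' : ContDiff ℝ ∞ (fun x => (g x : ℂ)) := Complex.ofRealCLM.contDiff.comp hg
  set G : SchwartzMap V ℂ := hgc'.toSchwartzMap hg' with hG
  have hGa : ∀ x, G x = (g x : ℂ) := fun x => rfl
  have h1 : (Lp.toTemperedDistribution (μ := volume) F) G =
      (Lp.toTemperedDistribution (μ := volume) (hf2.toLp f)) (𝓕 G) := by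
    rw [hF, ← Lp.fourier_toTemperedDistribution_eq, TemperedDistribution.fourier_apply]
  rw [Lp.toTemperedDistribution_apply, Lp.toTemperedDistribution_apply] at h1
  have h2 : ∫ x, (𝓕 G) x • (hf2.toLp f) x = ∫ x, f x * 𝓕 (G : V → ℂ) x := by
    refine integral_congr_ae ?_
    filter_upwards [hf2.coeFn_toLp] with x hx
    rw [hx, smul_eq_mul, mul_comm, SchwartzMap.fourier_coe]
  rw [h2, ← integral_fourier_mul_eq hf G.integrable] at h1
  simp only [hGa, smul_eq_mul] at h1
  simp only [Complex.real_smul]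
  rw [h1]
  simp only [mul_comm]

/-- Plancherel's identity on `L^1 ∩ L^2`. -/
theorem lintegral_enorm_fourier_sq {f : V → ℂ} (hf : Integrable f) (hf2 : MemLp f 2) :
    ∫⁻ ξ, ‖𝓕 f ξ‖ₑ ^ 2 = ∫⁻ x, ‖f x‖ₑ ^ 2 := by
  have key : eLpNorm (𝓕 f) 2 volume = eLpNorm f 2 volume := by
    rw [← eLpNorm_congr_ae (fourier_toLp_ae_eq hf hf2), ← eLpNorm_congr_ae hf2.coeFn_toLp]
    have := Lp.norm_fourier_eq (hf2.toLp f)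
    rw [Lp.norm_def, Lp.norm_def] at this
    exact (ENNReal.toReal_eq_toReal_iff' (Lp.eLpNorm_ne_top _) (Lp.eLpNorm_ne_top _)).1 this
  have h : ∀ u : V → ℂ, ∫⁻ ξ, ‖u ξ‖ₑ ^ 2 = eLpNorm u 2 volume ^ 2 := by
    intro u
    have := eLpNorm_nnreal_pow_eq_lintegral (f := u) (μ := volume) (p := 2) (by norm_num)
    simp only [NNReal.coe_ofNat, ENNReal.coe_ofNat, ENNReal.rpow_ofNat] at this
    exact this.symm
  rw [h, h, key]

theorem lintegral_enorm_fourierInv_sq {f : V → ℂ} (hf : Integrable f) (hf2 : MemLp f 2) :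
    ∫⁻ ξ, ‖𝓕⁻ f ξ‖ₑ ^ 2 = ∫⁻ x, ‖f x‖ₑ ^ 2 := by
  rw [← lintegral_enorm_fourier_sq hf hf2]
  simp only [Real.fourierInv_eq_fourier_neg]
  exact lintegral_neg_eq_self (μ := volume) (fun ξ => ‖𝓕 f ξ‖ₑ ^ 2)

end Plancherel

/-! ### Fourier transforms of `L^p` functions on balls -/

theorem volume_ball_eq {d : ℕ} (hd : 1 ≤ d) {R : ℝ} (hR : 0 ≤ R) (x : Space d) :
    volume (Metric.ball x R) =
      ENNReal.ofReal (R ^ d) * volume (Metric.ball (0 : Space d) 1) := by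
  have : Nonempty (Fin d) := ⟨⟨0, hd⟩⟩
  have := Measure.addHaar_ball (volume : Measure (Space d)) x hR
  simpa using this


theorem ennreal_add_sq_le (a b : ℝ≥0∞) : (a + b) ^ 2 ≤ 2 * (a ^ 2 + b ^ 2) := by
  have := ENNReal.rpow_add_le_mul_rpow_add_rpow a b (p := 2) (by norm_num)
  norm_num at this
  exact this

theorem enorm_fourier_le {d : ℕ} (f : Space d → ℂ) (hf : Integrable f) (ξ : Space d) :
    ‖𝓕 f ξ‖ₑ ≤ ∫⁻ x, ‖f x‖ₑ := by
  rw [← ofReal_integral_norm_eq_lintegral_enorm hf, ← ofReal_norm]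
  exact ENNReal.ofReal_le_ofReal (norm_fourier_le f ξ)

theorem fourier_add_apply {d : ℕ} {f g : Space d → ℂ} (hf : Integrable f) (hg : Integrable g)
    (ξ : Space d) : 𝓕 (f + g) ξ = 𝓕 f ξ + 𝓕 g ξ := by
  have := VectorFourier.fourierIntegral_add (μ := volume) (L := innerₗ (Space d))
    Real.continuous_fourierChar (by exact continuous_inner) hf hg
  have h2 := congrFun this ξ
  exact h2

/-- A function in `L^p`, `1 ≤ p ≤ 2`, has a Fourier transform whose `L^2` norm on the ball of radius
`R` is at most a constant times `R^{d (1 / p - 1 / 2)}` times the `L^p` norm. -/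
theorem lintegral_ball_enorm_fourier_sq_le {d : ℕ} (hd : 1 ≤ d) {p : ℝ} (hp1 : 1 ≤ p) (hp2 : p ≤ 2)
    {f : Space d → ℂ} (hfm : Measurable f) (hf : Integrable f) (hf2 : MemLp f 2)
    {R : ℝ} (hR : 0 < R) :
    ∫⁻ ξ in Metric.ball (0 : Space d) R, ‖𝓕 f ξ‖ₑ ^ 2 ≤
      2 * (volume (Metric.ball (0 : Space d) 1) + 1) * ENNReal.ofReal (R ^ (d * (2 / p - 1))) *
        (∫⁻ x, ‖f x‖ₑ ^ p) ^ (2 / p) := by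
  have hp0 : 0 < p := by linarith
  set I := ∫⁻ x, ‖f x‖ₑ ^ p with hI
  rcases eq_or_ne I 0 with h0 | h0
  · have hz : ∀ᵐ x, ‖f x‖ₑ = 0 := by
      have := (lintegral_eq_zero_iff (by fun_prop)).1 (hI ▸ h0)
      filter_upwards [this] with x hx
      simpa [hp0, hp0.not_gt] using hx
    have h1 : ∫⁻ x, ‖f x‖ₑ = 0 := by rw [lintegral_congr_ae hz]; simp
    have : ∀ ξ, ‖𝓕 f ξ‖ₑ = 0 := fun ξ => le_antisymm ((enorm_fourier_le f hf ξ).trans h1.le) bot_le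
    simp [this]
  rcases eq_or_ne I ⊤ with htop | htop
  · rw [htop, ENNReal.top_rpow_of_pos (by positivity), ENNReal.mul_top]
    · exact le_top
    · refine mul_ne_zero (by simp) ?_
      simpa using Real.rpow_pos_of_pos hR _
  set i := I.toReal with hi
  have hipos : 0 < i := ENNReal.toReal_pos h0 htop
  have hIi : I = ENNReal.ofReal i := (ENNReal.ofReal_toReal htop).symm
  -- Truncation at height `l` replaces interpolation. The part above `l` is estimated by its `L^1`
  -- norm, giving `l^{2-2p} I^2 R^d`; the part below by its `L^2` norm, giving `l^{2-p} I`. These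
  -- balance at `l^p = R^d I`.
  set l : ℝ := (R ^ d * i) ^ (1 / p) with hl
  have hlpos : 0 < l := by positivity
  set S : Set (Space d) := {x | l < ‖f x‖} with hS
  have hSm : MeasurableSet S := measurableSet_lt measurable_const hfm.norm
  have hg1 : Integrable (S.indicator f) := hf.indicator hSm
  have hg2 : Integrable (Sᶜ.indicator f) := hf.indicator hSm.compl
  have hsplit : f = S.indicator f + Sᶜ.indicator f := (Set.indicator_self_add_compl S f).symm
  have e1 : ∫⁻ x, ‖S.indicator f x‖ₑ ≤ ENNReal.ofReal (l ^ (1 - p)) * I := by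
    rw [hI, ← lintegral_const_mul _ (by fun_prop)]
    refine lintegral_mono fun x => ?_
    by_cases hx : x ∈ S
    · have hx' : l < ‖f x‖ := hx
      have hfx : 0 < ‖f x‖ := hlpos.trans hx'
      rw [Set.indicator_of_mem hx, ← ofReal_norm,
        ENNReal.ofReal_rpow_of_pos hfx, ← ENNReal.ofReal_mul (by positivity)]
      refine ENNReal.ofReal_le_ofReal ?_
      calc ‖f x‖ = ‖f x‖ ^ (1 - p) * ‖f x‖ ^ p := by
            rw [← Real.rpow_add hfx]; simp
        _ ≤ _ := by
            exact mul_le_mul_of_nonneg_right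
              (Real.rpow_le_rpow_of_nonpos hlpos hx'.le (by linarith)) (by positivity)
    · simp [hx]
  have e2 : ∫⁻ x, ‖Sᶜ.indicator f x‖ₑ ^ 2 ≤ ENNReal.ofReal (l ^ (2 - p)) * I := by
    rw [hI, ← lintegral_const_mul _ (by fun_prop)]
    refine lintegral_mono fun x => ?_
    by_cases hx : x ∈ S
    · simp [hx]
    · have hx' : ‖f x‖ ≤ l := not_lt.1 hx
      rw [Set.indicator_of_mem (by exact hx), ← ofReal_norm,
        ENNReal.ofReal_rpow_of_nonneg (norm_nonneg _) hp0.le, ← ENNReal.ofReal_mul (by positivity),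
        ← ENNReal.ofReal_pow (norm_nonneg _)]
      refine ENNReal.ofReal_le_ofReal ?_
      rcases (norm_nonneg (f x)).eq_or_lt with hz | hfx
      · rw [← hz]
        have : 0 ≤ l ^ (2 - p) * 0 ^ p := by positivity
        simpa using this
      calc ‖f x‖ ^ 2 = ‖f x‖ ^ (2 - p) * ‖f x‖ ^ p := by
            rw [← Real.rpow_add hfx]; simp
        _ ≤ _ := by
            gcongr
  have b1 : ∫⁻ ξ in Metric.ball (0 : Space d) R, ‖𝓕 (S.indicator f) ξ‖ₑ ^ 2 ≤
      (ENNReal.ofReal (l ^ (1 - p)) * I) ^ 2 *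
        (ENNReal.ofReal (R ^ d) * volume (Metric.ball (0 : Space d) 1)) := by
    rw [← volume_ball_eq hd hR.le 0, ← setLIntegral_const]
    refine lintegral_mono fun ξ => ?_
    gcongr
    exact (enorm_fourier_le _ hg1 ξ).trans e1
  have b2 : ∫⁻ ξ in Metric.ball (0 : Space d) R, ‖𝓕 (Sᶜ.indicator f) ξ‖ₑ ^ 2 ≤
      ENNReal.ofReal (l ^ (2 - p)) * I := by
    refine (setLIntegral_le_lintegral _ _).trans ?_
    rw [lintegral_enorm_fourier_sq hg2 (hf2.indicator hSm.compl)]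
    exact e2
  -- Writing positive reals as exponentials turns the power identities below into identities of
  -- exponents.
  have hlog : ∀ y : ℝ, 0 < y → ∃ z, y = Real.exp z := fun y hy => ⟨_, (Real.exp_log hy).symm⟩
  have a1 : (ENNReal.ofReal (l ^ (1 - p)) * I) ^ 2 * ENNReal.ofReal (R ^ d) =
      ENNReal.ofReal (R ^ (d * (2 / p - 1))) * I ^ (2 / p) := by
    rw [hIi, ENNReal.ofReal_rpow_of_pos hipos, ← ENNReal.ofReal_mul (by positivity),
      ← ENNReal.ofReal_pow (by positivity), ← ENNReal.ofReal_mul (by positivity),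
      ← ENNReal.ofReal_mul (by positivity), hl]
    congr 1
    obtain ⟨r, rfl⟩ := hlog R hR
    obtain ⟨s, hs⟩ := hlog i hipos
    simp only [hs, ← Real.exp_nat_mul, ← Real.exp_add, ← Real.exp_mul]
    congr 1
    push_cast
    field_simp
    ring
  have a2 : ENNReal.ofReal (l ^ (2 - p)) * I =
      ENNReal.ofReal (R ^ (d * (2 / p - 1))) * I ^ (2 / p) := by
    rw [hIi, ENNReal.ofReal_rpow_of_pos hipos, ← ENNReal.ofReal_mul (by positivity),
      ← ENNReal.ofReal_mul (by positivity), hl]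
    congr 1
    obtain ⟨r, rfl⟩ := hlog R hR
    obtain ⟨s, hs⟩ := hlog i hipos
    simp only [hs, ← Real.exp_nat_mul, ← Real.exp_add, ← Real.exp_mul]
    congr 1
    field_simp
    ring
  calc ∫⁻ ξ in Metric.ball (0 : Space d) R, ‖𝓕 f ξ‖ₑ ^ 2
      ≤ ∫⁻ ξ in Metric.ball (0 : Space d) R,
          2 * (‖𝓕 (S.indicator f) ξ‖ₑ ^ 2 + ‖𝓕 (Sᶜ.indicator f) ξ‖ₑ ^ 2) := by
        refine lintegral_mono fun ξ => ?_
        conv_lhs => rw [hsplit, fourier_add_apply hg1 hg2]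
        exact (pow_le_pow_left' (enorm_add_le _ _) 2).trans (ennreal_add_sq_le _ _)
    _ = 2 * ((∫⁻ ξ in Metric.ball (0 : Space d) R, ‖𝓕 (S.indicator f) ξ‖ₑ ^ 2) +
          ∫⁻ ξ in Metric.ball (0 : Space d) R, ‖𝓕 (Sᶜ.indicator f) ξ‖ₑ ^ 2) := by
        have m1 := (continuous_fourier hg1).measurable
        have m2 := (continuous_fourier hg2).measurable
        rw [lintegral_const_mul _ (by fun_prop), lintegral_add_left (by fun_prop)]
    _ ≤ 2 * ((ENNReal.ofReal (l ^ (1 - p)) * I) ^ 2 *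
        (ENNReal.ofReal (R ^ d) * volume (Metric.ball (0 : Space d) 1)) +
          ENNReal.ofReal (l ^ (2 - p)) * I) := by gcongr
    _ = _ := by
        rw [← mul_assoc (_ ^ 2), a1, a2]
        ring

/-! ### Characters, `μ̂` and its reproducing kernel in time -/

variable {d : ℕ}

/-- The phase `y·ξ + z·η`. -/
def phase (w ζ : Space d × Space d) : ℝ := ⟪w.1, ζ.1⟫ + ⟪w.2, ζ.2⟫

/-- The character `exp (2πi s)`. -/
def expi (s : ℝ) : ℂ := Complex.exp (((2 * Real.pi * s : ℝ) : ℂ) * Complex.I)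

theorem norm_expi (s : ℝ) : ‖expi s‖ = 1 := Complex.norm_exp_ofReal_mul_I _

theorem expi_add (s t : ℝ) : expi (s + t) = expi s * expi t := by
  unfold expi
  rw [← Complex.exp_add]
  congr 1
  push_cast
  ring

@[fun_prop]
theorem continuous_expi : Continuous expi := by unfold expi; fun_prop

theorem continuous_phase_left (ζ : Space d × Space d) : Continuous fun w => phase w ζ := by
  unfold phase; fun_prop

theorem continuous_phase_right (w : Space d × Space d) : Continuous fun ζ => phase w ζ := by
  unfold phase; fun_prop

theorem phase_smul (t : ℝ) (w ζ : Space d × Space d) : phase w (t • ζ) = t * phase w ζ := by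
  simp [phase, inner_smul_right]; ring

theorem abs_phase_le (w ζ : Space d × Space d) : |phase w ζ| ≤ 2 * ‖w‖ * ‖ζ‖ := by
  have h1 := (abs_real_inner_le_norm w.1 ζ.1).trans
    (mul_le_mul (norm_fst_le w) (norm_fst_le ζ) (norm_nonneg _) (norm_nonneg _))
  have h2 := (abs_real_inner_le_norm w.2 ζ.2).trans
    (mul_le_mul (norm_snd_le w) (norm_snd_le ζ) (norm_nonneg _) (norm_nonneg _))
  have h3 := abs_add_le ⟪w.1, ζ.1⟫ ⟪w.2, ζ.2⟫
  unfold phase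
  linarith

theorem fourierMeasure_eq (μ : Measure (Space d × Space d)) (ζ : Space d × Space d) :
    fourierMeasure μ ζ = ∫ w, expi (-phase w ζ) ∂μ := by
  unfold fourierMeasure expi phase
  congr 1
  ext w
  congr 2
  push_cast
  ring

theorem continuous_fourierMeasure (μ : Measure (Space d × Space d)) [IsFiniteMeasure μ] :
    Continuous (fourierMeasure μ) := by
  simp only [funext (fourierMeasure_eq μ)]
  refine continuous_of_dominated (bound := fun _ => 1) (fun ζ => ?_) (fun ζ => ?_)
    (integrable_const _) ?_
  · exact (continuous_expi.comp (continuous_phase_left ζ).neg).aestronglyMeasurable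
  · exact .of_forall fun w => (norm_expi _).le
  · exact .of_forall fun w => continuous_expi.comp (continuous_phase_right w).neg

theorem norm_fourierMeasure_le (μ : Measure (Space d × Space d)) [IsFiniteMeasure μ]
    (ζ : Space d × Space d) : ‖fourierMeasure μ ζ‖ ≤ μ.real Set.univ := by
  rw [fourierMeasure_eq]
  refine (norm_integral_le_integral_norm _).trans ?_
  simp [norm_expi]

/-- A compactly supported measure has `‖w‖ ≤ ρ` almost everywhere for some `ρ`. -/
theorem CompactlySupported.exists_norm_le {μ : Measure (Space d × Space d)}
    (hμ : CompactlySupported μ) : ∃ ρ : ℝ, 0 < ρ ∧ ∀ᵐ w ∂μ, ‖w‖ ≤ ρ := by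
  obtain ⟨K, hK, h0⟩ := hμ
  obtain ⟨ρ, hρ, h⟩ := hK.isBounded.exists_pos_norm_le
  refine ⟨ρ, hρ, ?_⟩
  have : ∀ᵐ w ∂μ, w ∈ K := by rwa [ae_iff]
  filter_upwards [this] with w hw using h w hw

/-- There is a Schwartz function whose Fourier integral is `1` on a given bounded interval. -/
theorem exists_schwartz_integral_expi_eq_one (ρ : ℝ) (hρ : 0 < ρ) :
    ∃ κ : SchwartzMap ℝ ℂ, ∀ y : ℝ, |y| ≤ ρ → ∫ u, κ u * expi (u * y) = 1 := by
  let b : ContDiffBump (0 : ℝ) := ⟨ρ, ρ + 1, hρ, by linarith⟩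
  have hc : HasCompactSupport (fun x => (b x : ℂ)) :=
    b.hasCompactSupport.comp_left (g := Complex.ofReal) rfl
  have hs : ContDiff ℝ ∞ (fun x => (b x : ℂ)) := Complex.ofRealCLM.contDiff.comp b.contDiff
  set φ : SchwartzMap ℝ ℂ := hc.toSchwartzMap hs with hφ
  -- The kernel is the Fourier transform of a bump equal to `1` on `[-ρ, ρ]`; the claim is Fourier
  -- inversion.
  refine ⟨𝓕 φ, fun y hy => ?_⟩
  have h1 : 𝓕⁻ (𝓕 φ) y = 1 := by
    rw [FourierTransform.fourierInv_fourier_eq]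
    change ((b y : ℝ) : ℂ) = 1
    rw [b.one_of_mem_closedBall (by simpa using hy)]
    simp
  rw [← h1, SchwartzMap.fourierInv_coe, Real.fourierInv_eq']
  congr 1
  ext u
  simp only [smul_eq_mul, expi]
  rw [mul_comm]
  congr 3
  simp
  ring

/-- On frequencies `‖ζ‖ ≤ 1 / δ` the multiplier `μ̂(t ζ)` is reproduced by averaging over
times at distance `O(δ)`, with a kernel that does not depend on `ζ`. -/
theorem exists_reproducing_kernel {μ : Measure (Space d × Space d)} [IsFiniteMeasure μ]
    (hμ : CompactlySupported μ) :
    ∃ κ : SchwartzMap ℝ ℂ, ∀ (δ c τ : ℝ) (ζ : Space d × Space d), 0 < δ → δ * ‖ζ‖ ≤ 1 →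
      fourierMeasure μ ((c + δ * τ) • ζ) =
        ∫ v, κ (τ - v) * fourierMeasure μ ((c + δ * v) • ζ) := by
  obtain ⟨ρ, hρ, hw⟩ := hμ.exists_norm_le
  -- The band limit `2ρ` comes from `|phase w ζ| ≤ 2‖w‖‖ζ‖`, `‖w‖ ≤ ρ` and `δ‖ζ‖ ≤ 1`.
  obtain ⟨κ, hκ⟩ := exists_schwartz_integral_expi_eq_one (2 * ρ) (by positivity)
  refine ⟨κ, fun δ c τ ζ hδ hζ => ?_⟩
  have e1 : fourierMeasure μ ((c + δ * τ) • ζ) =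
      ∫ w, (∫ u, κ u * expi (-((c + δ * (τ - u)) * phase w ζ))) ∂μ := by
    rw [fourierMeasure_eq]
    refine integral_congr_ae ?_
    filter_upwards [hw] with w hw
    have hy : |δ * phase w ζ| ≤ 2 * ρ := by
      rw [abs_mul, abs_of_pos hδ]
      calc δ * |phase w ζ| ≤ δ * (2 * ‖w‖ * ‖ζ‖) := by gcongr; exact abs_phase_le w ζ
        _ = 2 * ‖w‖ * (δ * ‖ζ‖) := by ring
        _ ≤ 2 * ρ * 1 := by gcongr
        _ = 2 * ρ := by ring
    rw [phase_smul, ← mul_one (expi _), ← hκ _ hy, ← integral_const_mul]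
    congr 1
    ext u
    rw [mul_left_comm, ← expi_add]
    congr 2
    ring
  rw [e1, integral_integral_swap]
  · rw [← integral_sub_left_eq_self _ volume τ]
    congr 1
    ext v
    rw [integral_const_mul, fourierMeasure_eq]
    simp only [phase_smul, sub_sub_cancel]
  · have hcont : Continuous (Function.uncurry fun (w : Space d × Space d) (u : ℝ) =>
        expi (-((c + δ * (τ - u)) * phase w ζ))) := by
      unfold phase Function.uncurry
      fun_prop
    have hi : Integrable (fun z : (Space d × Space d) × ℝ => κ z.2) (μ.prod volume) :=
      κ.integrable.comp_snd μ
    refine hi.mono ?_ (.of_forall fun z => ?_)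
    · exact hi.aestronglyMeasurable.mul hcont.aestronglyMeasurable
    · simp [Function.uncurry, norm_expi]

/-- A Schwartz function, translated by `τ ∈ [0, 1]`, is bounded by a power weight. -/
theorem exists_schwartz_translate_le (κ : SchwartzMap ℝ ℂ) (N : ℕ) :
    ∃ C : ℝ, 0 ≤ C ∧ ∀ τ v : ℝ, 0 ≤ τ → τ ≤ 1 → ‖κ (τ - v)‖ ≤ C * (1 + |v|) ^ (-(N : ℝ)) := by
  set B := 2 ^ N * (Finset.Iic (N, 0)).sup (fun m => SchwartzMap.seminorm ℝ m.1 m.2) κ with hB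
  have hB0 : 0 ≤ B := by positivity
  refine ⟨2 ^ N * B, by positivity, fun τ v h0 h1 => ?_⟩
  have h := SchwartzMap.one_add_le_sup_seminorm_apply (𝕜 := ℝ) (m := (N, 0)) (k := N) (n := 0)
    le_rfl le_rfl κ (τ - v)
  rw [norm_iteratedFDeriv_zero] at h
  have hv : 1 + |v| ≤ 2 * (1 + ‖τ - v‖) := by
    have : |v| ≤ |τ| + |τ - v| := by
      calc |v| = |τ - (τ - v)| := by ring_nf
        _ ≤ _ := abs_sub _ _
    rw [abs_of_nonneg h0] at this
    rw [Real.norm_eq_abs]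
    linarith [abs_nonneg (τ - v)]
  have hpos : 0 < 1 + |v| := by positivity
  rw [Real.rpow_neg hpos.le, Real.rpow_natCast, ← div_eq_mul_inv, le_div_iff₀ (by positivity)]
  calc ‖κ (τ - v)‖ * (1 + |v|) ^ N ≤ ‖κ (τ - v)‖ * (2 * (1 + ‖τ - v‖)) ^ N := by gcongr
    _ = 2 ^ N * ((1 + ‖τ - v‖) ^ N * ‖κ (τ - v)‖) := by rw [mul_pow]; ring
    _ ≤ 2 ^ N * B := by gcongr

/-- Decay of `m((c + δ v) ζ)` for `‖ζ‖ ≳ 1 / δ`, with polynomial loss in `v`. -/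
theorem IsAdmissible.exists_norm_le {a : ℝ} {m : Space d × Space d → ℂ} (h : IsAdmissible a m) :
    ∃ C : ℝ, 0 ≤ C ∧ ∀ (δ c v : ℝ) (ζ : Space d × Space d), 0 < δ → δ ≤ 1 → 1 - δ ≤ c →
      (δ = 1 ∨ 1 ≤ 2 * (δ * ‖ζ‖)) →
        ‖m ((c + δ * v) • ζ)‖ ≤ C * δ ^ a * (1 + |v|) ^ a := by
  obtain ⟨had, C, hC⟩ := h
  have ha : 0 < a := lt_of_le_of_lt (by positivity) had
  have hC0 : 0 ≤ C := by simpa using (norm_nonneg _).trans (hC 0 0)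
  refine ⟨C * 2 ^ a, by positivity, fun δ c v ζ hδ hδ1 hc hζ => ?_⟩
  set s := c + δ * v with hs
  have h1 : ‖m (s • ζ)‖ ≤ C * (1 + |s| * ‖ζ‖) ^ (-a) := by
    refine (hC (s • ζ.1) (s • ζ.2)).trans ?_
    refine mul_le_mul_of_nonneg_left ?_ hC0
    refine Real.rpow_le_rpow_of_nonpos (by positivity) ?_ (by linarith)
    rw [norm_smul, norm_smul, Real.norm_eq_abs]
    have : ‖ζ‖ ≤ ‖ζ.1‖ + ‖ζ.2‖ :=
      max_le (le_add_of_nonneg_right (norm_nonneg _)) (le_add_of_nonneg_left (norm_nonneg _))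
    nlinarith [mul_le_mul_of_nonneg_left this (abs_nonneg s)]
  have hsv : 1 - δ - δ * |v| ≤ |s| := by
    have : -|v| ≤ v := neg_abs_le v
    have h2 : δ * (-|v|) ≤ δ * v := by gcongr
    linarith [le_abs_self s]
  have hX : 0 < 1 + |s| * ‖ζ‖ := by positivity
  have hV : 0 < 1 + |v| := by positivity
  -- The time `s` may come near `0`, where `μ̂(sζ)` has no decay. But `|s| + δ|v| ≥ 1 - δ`, so this
  -- needs `δ|v|` large, and the factor `1 + |v|` pays for it.
  have h2 : (1 + |s| * ‖ζ‖)⁻¹ ≤ 2 * δ * (1 + |v|) := by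
    rw [inv_le_iff_one_le_mul₀ hX]
    rcases hζ with rfl | hζ
    · nlinarith [mul_nonneg (abs_nonneg v) (mul_nonneg (abs_nonneg s) (norm_nonneg ζ)),
        abs_nonneg v, mul_nonneg (abs_nonneg s) (norm_nonneg ζ)]
    · have h3 : |s| ≤ |s| * (2 * (δ * ‖ζ‖)) := le_mul_of_one_le_right (abs_nonneg s) hζ
      have h4 : 0 ≤ |s| * ‖ζ‖ * (δ * |v|) := by positivity
      have h5 : 0 ≤ δ * |v| := by positivity
      nlinarith
  calc ‖m (s • ζ)‖ ≤ C * (1 + |s| * ‖ζ‖) ^ (-a) := h1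
    _ = C * ((1 + |s| * ‖ζ‖)⁻¹) ^ a := by rw [Real.inv_rpow hX.le, Real.rpow_neg hX.le]
    _ ≤ C * (2 * δ * (1 + |v|)) ^ a := by gcongr
    _ = _ := by
      rw [Real.mul_rpow (by positivity) hV.le, Real.mul_rpow (by positivity) hδ.le]
      ring

/-! ### Cauchy-Schwarz and the fixed-time `L^2` bound -/

theorem lintegral_mul_sq_le {α : Type*} [MeasurableSpace α] (μ : Measure α) {f g : α → ℝ≥0∞}
    (hf : AEMeasurable f μ) (hg : AEMeasurable g μ) :
    (∫⁻ x, f x * g x ∂μ) ^ 2 ≤ (∫⁻ x, f x ^ 2 ∂μ) * ∫⁻ x, g x ^ 2 ∂μ := by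
  have h := ENNReal.lintegral_mul_le_Lp_mul_Lq μ Real.HolderConjugate.two_two hf hg
  simp only [Pi.mul_apply, ENNReal.rpow_ofNat] at h
  refine (pow_le_pow_left' h 2).trans_eq ?_
  rw [mul_pow, ← ENNReal.rpow_natCast, ← ENNReal.rpow_natCast, ← ENNReal.rpow_mul,
    ← ENNReal.rpow_mul]
  norm_num

theorem setLIntegral_sq_le {α : Type*} [MeasurableSpace α] (μ : Measure α) (A : Set α)
    {f : α → ℝ≥0∞} (hf : AEMeasurable f μ) :
    (∫⁻ x in A, f x ∂μ) ^ 2 ≤ μ A * ∫⁻ x in A, f x ^ 2 ∂μ := by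
  have h := lintegral_mul_sq_le (μ.restrict A) (f := fun _ => 1) aemeasurable_const hf.restrict
  simpa using h

/-- Cauchy-Schwarz with `k` split as `k^{1/2} · k^{1/2}`. It serves for the time average with a
decaying kernel and, with counting measure, for the sum over dyadic scales. -/
theorem lintegral_weight_mul_sq_le {α : Type*} [MeasurableSpace α] (μ : Measure α)
    {k f : α → ℝ≥0∞} (hk : AEMeasurable k μ) (hf : AEMeasurable f μ) :
    (∫⁻ x, k x * f x ∂μ) ^ 2 ≤ (∫⁻ x, k x ∂μ) * ∫⁻ x, k x * f x ^ 2 ∂μ := by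
  have hs : ∀ y : ℝ≥0∞, y ^ (2⁻¹ : ℝ) * y ^ (2⁻¹ : ℝ) = y := fun y => by
    rw [← ENNReal.rpow_add_of_nonneg _ _ (by norm_num) (by norm_num)]; norm_num
  have h := lintegral_mul_sq_le μ (f := fun x => k x ^ (2⁻¹ : ℝ))
    (g := fun x => k x ^ (2⁻¹ : ℝ) * f x) (by fun_prop) (by fun_prop)
  simpa only [← mul_assoc, hs, mul_pow, sq (_ ^ (2⁻¹ : ℝ))] using h

theorem iSup₂_sq_le {ι : Type*} {E : Set ι} {F : ι → ℝ≥0∞} {B : ℝ≥0∞}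
    (h : ∀ t ∈ E, F t ^ 2 ≤ B) : (⨆ t ∈ E, F t) ^ 2 ≤ B := by
  have hsq : (B ^ (2⁻¹ : ℝ)) ^ 2 = B := by
    rw [← ENNReal.rpow_natCast, ← ENNReal.rpow_mul]; norm_num
  rw [← hsq]
  refine pow_le_pow_left' (iSup₂_le fun t ht => ?_) 2
  calc F t = (F t ^ 2) ^ (2⁻¹ : ℝ) := by
        rw [← ENNReal.rpow_natCast, ← ENNReal.rpow_mul]; norm_num
    _ ≤ B ^ (2⁻¹ : ℝ) := by
        gcongr
        exact h t ht

/-- The function `x ↦ ∫ G(ξ, η) exp (2πi x·(ξ + η)) dξ dη`. -/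
def sumFourier (G : Space d × Space d → ℂ) (x : Space d) : ℂ :=
  ∫ ζ : Space d × Space d, G ζ * expi ⟪x, ζ.1 + ζ.2⟫

theorem measurePreserving_shear : MeasurePreserving
    (fun z : Space d × Space d => (z.1, z.2 - z.1)) (volume.prod volume) (volume.prod volume) := by
  have h := measurePreserving_prod_neg_add (volume : Measure (Space d)) (volume : Measure (Space d))
  simpa only [neg_add_eq_sub] using h

theorem measurableEmbedding_shear : MeasurableEmbedding
    (fun z : Space d × Space d => (z.1, z.2 - z.1)) := by
  have : (fun z : Space d × Space d => (z.1, z.2 - z.1)) =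
      (MeasurableEquiv.shearAddRight (Space d)).symm := by
    ext z <;> simp [MeasurableEquiv.shearAddRight, neg_add_eq_sub]
  rw [this]
  exact MeasurableEquiv.measurableEmbedding _

/-- The phase depends on `(ξ, η)` only through `s = ξ + η`, so after a shear the variable `ξ`
integrates out and an inverse Fourier transform in `s` remains. -/
theorem sumFourier_eq_fourierInv {G : Space d × Space d → ℂ} (hG : Integrable G) :
    sumFourier G = 𝓕⁻ fun s => ∫ ξ, G (ξ, s - ξ) := by
  ext x
  have hsh : Integrable (fun z : Space d × Space d => G (z.1, z.2 - z.1))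
      (volume.prod volume) :=
    measurePreserving_shear.integrable_comp_of_integrable hG
  have hI : Integrable (fun z : Space d × Space d => G (z.1, z.2 - z.1) * expi ⟪x, z.2⟫)
      (volume.prod volume) := by
    refine hsh.mono (hsh.aestronglyMeasurable.mul ?_) (.of_forall fun z => ?_)
    · exact Continuous.aestronglyMeasurable (by fun_prop)
    · simp [norm_expi]
  unfold sumFourier
  have h1 := measurePreserving_shear.integral_comp measurableEmbedding_shear
    (fun ζ : Space d × Space d => G ζ * expi ⟪x, ζ.1 + ζ.2⟫)
  simp only [add_sub_cancel] at h1
  rw [Measure.volume_eq_prod, ← h1, integral_prod_symm _ hI, Real.fourierInv_eq']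
  congr 1
  ext s
  dsimp only
  rw [integral_mul_const, smul_eq_mul, mul_comm, expi, real_inner_comm]

/-- The `L^2` bound behind all estimates: a bounded multiplier on the product of two balls of radius
`R` loses only the factor `|B_R|^{1/2}`. -/
theorem lintegral_enorm_sumFourier_sq_le {G : Space d × Space d → ℂ} {u v : Space d → ℂ}
    (hGm : Measurable G) (hu : Continuous u) (hv : Continuous v) {B : ℝ≥0} {R : ℝ}
    (hG : ∀ ζ, ‖G ζ‖ₑ ≤ B * (‖u ζ.1‖ₑ * ‖v ζ.2‖ₑ))
    (hG0 : ∀ ζ, G ζ ≠ 0 → ‖ζ.1‖ < R ∧ ‖ζ.2‖ < R) :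
    ∫⁻ x, ‖sumFourier G x‖ₑ ^ 2 ≤ (B : ℝ≥0∞) ^ 2 * volume (Metric.ball (0 : Space d) R) *
      ((∫⁻ ξ in Metric.ball (0 : Space d) R, ‖u ξ‖ₑ ^ 2) *
        ∫⁻ η in Metric.ball (0 : Space d) R, ‖v η‖ₑ ^ 2) := by
  set A := Metric.ball (0 : Space d) R with hA
  have hAm : MeasurableSet A := measurableSet_ball
  have hfin : ∀ w : Space d → ℂ, Continuous w → ∀ n : ℕ, ∫⁻ ξ in A, ‖w ξ‖ₑ ^ n < ⊤ := by
    intro w hw n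
    obtain ⟨c, hc⟩ := (isCompact_closedBall (0 : Space d) R).exists_bound_of_continuousOn
      hw.continuousOn
    refine lt_of_le_of_lt (setLIntegral_mono' (g := fun _ => ENNReal.ofReal c ^ n) hAm
      fun ξ hξ => ?_) ?_
    · rw [← ofReal_norm]
      gcongr
      exact hc ξ (Metric.ball_subset_closedBall hξ)
    · rw [setLIntegral_const]
      exact ENNReal.mul_lt_top (by finiteness) measure_ball_lt_top
  -- Needed for `n = 1`, which gives integrability of `G`, and for `n = 2`, which gives the bound
  -- itself.
  have hGb : ∀ ζ, ∀ n : ℕ, n ≠ 0 → ‖G ζ‖ₑ ^ n ≤ (B : ℝ≥0∞) ^ n *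
      ((A.indicator (fun ξ => ‖u ξ‖ₑ ^ n) ζ.1) * A.indicator (fun ξ => ‖v ξ‖ₑ ^ n) ζ.2) := by
    intro ζ n hn
    by_cases h0 : G ζ = 0
    · simp [h0, hn]
    · have h1 : ζ.1 ∈ A := by simpa [hA] using (hG0 ζ h0).1
      have h2 : ζ.2 ∈ A := by simpa [hA] using (hG0 ζ h0).2
      rw [Set.indicator_of_mem h1, Set.indicator_of_mem h2, ← mul_pow, ← mul_pow]
      gcongr
      exact hG ζ
  have hGL : ∀ n : ℕ, n ≠ 0 → ∫⁻ ζ, ‖G ζ‖ₑ ^ n ≤ (B : ℝ≥0∞) ^ n *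
      ((∫⁻ ξ in A, ‖u ξ‖ₑ ^ n) * ∫⁻ η in A, ‖v η‖ₑ ^ n) := by
    intro n hn
    refine (lintegral_mono fun ζ => hGb ζ n hn).trans_eq ?_
    have m1 : Measurable (A.indicator fun ξ => ‖u ξ‖ₑ ^ n) :=
      Measurable.indicator (by fun_prop) hAm
    have m2 : Measurable (A.indicator fun ξ => ‖v ξ‖ₑ ^ n) :=
      Measurable.indicator (by fun_prop) hAm
    rw [lintegral_const_mul _ (by fun_prop), Measure.volume_eq_prod,
      lintegral_prod_mul m1.aemeasurable m2.aemeasurable, lintegral_indicator hAm,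
      lintegral_indicator hAm]
  have hGi : Integrable G := by
    refine ⟨hGm.aestronglyMeasurable, ?_⟩
    have h := hGL 1 one_ne_zero
    simp only [pow_one] at h
    refine h.trans_lt (ENNReal.mul_lt_top (by finiteness) (ENNReal.mul_lt_top ?_ ?_))
    · simpa using hfin u hu 1
    · simpa using hfin v hv 1
  set H : Space d → ℂ := fun s => ∫ ξ, G (ξ, s - ξ) with hH
  have hsh : Integrable (fun z : Space d × Space d => G (z.1, z.2 - z.1))
      (volume.prod volume) :=
    measurePreserving_shear.integrable_comp_of_integrable hGi
  have hHi : Integrable H := hsh.integral_prod_right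
  -- Cauchy-Schwarz in `ξ`, which ranges over the ball `A`; this is the only source of the factor
  -- `|B_R|`.
  have hpt : ∀ s, ‖H s‖ₑ ^ 2 ≤ volume A * ∫⁻ ξ, ‖G (ξ, s - ξ)‖ₑ ^ 2 := by
    intro s
    have h1 : ‖H s‖ₑ ≤ ∫⁻ ξ in A, ‖G (ξ, s - ξ)‖ₑ := by
      refine (enorm_integral_le_lintegral_enorm _).trans_eq ?_
      rw [← lintegral_indicator hAm]
      congr 1
      ext ξ
      by_cases h0 : G (ξ, s - ξ) = 0
      · simp [h0, Set.indicator]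
      · rw [Set.indicator_of_mem]
        simpa [hA] using (hG0 _ h0).1
    refine (pow_le_pow_left' h1 2).trans ((setLIntegral_sq_le _ _ (by fun_prop)).trans ?_)
    gcongr
    exact Measure.restrict_le_self
  have hL2 : ∫⁻ s, ‖H s‖ₑ ^ 2 ≤ (B : ℝ≥0∞) ^ 2 * volume A *
      ((∫⁻ ξ in A, ‖u ξ‖ₑ ^ 2) * ∫⁻ η in A, ‖v η‖ₑ ^ 2) := by
    calc ∫⁻ s, ‖H s‖ₑ ^ 2 ≤ ∫⁻ s, volume A * ∫⁻ ξ, ‖G (ξ, s - ξ)‖ₑ ^ 2 := lintegral_mono hpt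
      _ = volume A * ∫⁻ s, ∫⁻ ξ, ‖G (ξ, s - ξ)‖ₑ ^ 2 := by
        rw [lintegral_const_mul' _ _ measure_ball_lt_top.ne]
      _ = volume A * ∫⁻ z : Space d × Space d, ‖G (z.1, z.2 - z.1)‖ₑ ^ 2
            ∂(volume.prod volume) := by
        rw [lintegral_prod_symm' _ (by fun_prop)]
      _ = volume A * ∫⁻ ζ : Space d × Space d, ‖G ζ‖ₑ ^ 2 := by
        rw [measurePreserving_shear.lintegral_comp (f := fun ζ => ‖G ζ‖ₑ ^ 2) (by fun_prop),
          Measure.volume_eq_prod]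
      _ ≤ volume A * ((B : ℝ≥0∞) ^ 2 *
            ((∫⁻ ξ in A, ‖u ξ‖ₑ ^ 2) * ∫⁻ η in A, ‖v η‖ₑ ^ 2)) := by
        gcongr
        exact hGL 2 two_ne_zero
      _ = _ := by ring
  have hH2 : MemLp H 2 := by
    refine ⟨hHi.aestronglyMeasurable, ?_⟩
    rw [eLpNorm_lt_top_iff_lintegral_rpow_enorm_lt_top (by norm_num) (by norm_num)]
    simp only [ENNReal.toReal_ofNat, ENNReal.rpow_ofNat]
    refine hL2.trans_lt (ENNReal.mul_lt_top (ENNReal.mul_lt_top (by finiteness)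
      measure_ball_lt_top) (ENNReal.mul_lt_top (hfin u hu 2) (hfin v hv 2)))
  rw [sumFourier_eq_fourierInv hGi, lintegral_enorm_fourierInv_sq hHi hH2]
  exact hL2

/-! ### Frequency pieces and the maximal estimate at one scale -/

/-- The part of the bilinear multiplier operator at time `t` with frequencies in `D`, where `u` and
`v` are the Fourier transforms of the two functions. -/
def frequencyPiece (μ : Measure (Space d × Space d)) (D : Set (Space d × Space d))
    (u v : Space d → ℂ) (t : ℝ) (x : Space d) : ℂ :=
  sumFourier (D.indicator fun ζ => u ζ.1 * v ζ.2 * fourierMeasure μ (t • ζ)) x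

section

variable {μ : Measure (Space d × Space d)} [IsFiniteMeasure μ] {D : Set (Space d × Space d)}
  {u v : Space d → ℂ}

theorem integrable_prod_mul {u v : Space d → ℂ} (hu : Integrable u) (hv : Integrable v) :
    Integrable (fun ζ : Space d × Space d => u ζ.1 * v ζ.2) :=
  hu.mul_prod hv

theorem measurable_piece_integrand (hD : MeasurableSet D) (hu : Continuous u) (hv : Continuous v)
    (t : ℝ) :
    Measurable (D.indicator fun ζ => u ζ.1 * v ζ.2 * fourierMeasure μ (t • ζ)) := by
  have := (continuous_fourierMeasure μ).measurable
  exact Measurable.indicator (by fun_prop) hD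

theorem norm_piece_integrand_le (t : ℝ) (ζ : Space d × Space d) :
    ‖D.indicator (fun ζ => u ζ.1 * v ζ.2 * fourierMeasure μ (t • ζ)) ζ‖ ≤
      ‖u ζ.1 * v ζ.2‖ * μ.real Set.univ := by
  by_cases hζ : ζ ∈ D
  · rw [Set.indicator_of_mem hζ, norm_mul]
    gcongr
    exact norm_fourierMeasure_le μ _
  · rw [Set.indicator_of_notMem hζ, norm_zero]
    positivity

/-- Joint continuity in time and space makes suprema over times measurable and allows Tonelli for
averages over times. -/
theorem continuous_frequencyPiece (hD : MeasurableSet D) (hu : Continuous u) (hv : Continuous v)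
    (hui : Integrable u) (hvi : Integrable v) :
    Continuous fun z : ℝ × Space d => frequencyPiece μ D u v z.1 z.2 := by
  unfold frequencyPiece sumFourier
  refine continuous_of_dominated (bound := fun ζ => ‖u ζ.1 * v ζ.2‖ * μ.real Set.univ)
    (fun z => ?_) (fun z => .of_forall fun ζ => ?_)
    ((integrable_prod_mul hui hvi).norm.mul_const _) (.of_forall fun ζ => ?_)
  · exact ((measurable_piece_integrand hD hu hv z.1).mul
      (by fun_prop : Continuous _).measurable).aestronglyMeasurable
  · rw [norm_mul, norm_expi, mul_one]
    exact norm_piece_integrand_le _ _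
  · refine Continuous.mul ?_ (by fun_prop)
    by_cases hζ : ζ ∈ D
    · simp only [Set.indicator_of_mem hζ]
      have := continuous_fourierMeasure μ
      fun_prop
    · simp only [Set.indicator_of_notMem hζ]
      exact continuous_const

/-- The reproducing formula for the multiplier, passed to the operator. -/
theorem frequencyPiece_eq_integral {κ : SchwartzMap ℝ ℂ} {δ c τ : ℝ}
    (hκ : ∀ ζ ∈ D, fourierMeasure μ ((c + δ * τ) • ζ) =
        ∫ s, κ (τ - s) * fourierMeasure μ ((c + δ * s) • ζ))
    (hD : MeasurableSet D) (hu : Continuous u) (hv : Continuous v)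
    (hui : Integrable u) (hvi : Integrable v) (x : Space d) :
    frequencyPiece μ D u v (c + δ * τ) x =
      ∫ s, κ (τ - s) * frequencyPiece μ D u v (c + δ * s) x := by
  have hκi : Integrable fun s => κ (τ - s) := κ.integrable.comp_sub_left τ
  have e1 : frequencyPiece μ D u v (c + δ * τ) x = ∫ ζ : Space d × Space d, ∫ s,
      κ (τ - s) * (D.indicator (fun ζ => u ζ.1 * v ζ.2 *
        fourierMeasure μ ((c + δ * s) • ζ)) ζ * expi ⟪x, ζ.1 + ζ.2⟫) := by
    unfold frequencyPiece sumFourier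
    congr 1
    ext ζ
    by_cases hζ : ζ ∈ D
    · simp only [Set.indicator_of_mem hζ]
      rw [hκ ζ hζ, ← integral_const_mul, ← integral_mul_const]
      congr 1
      ext s
      ring
    · simp [Set.indicator_of_notMem hζ]
  rw [e1, integral_integral_swap]
  · simp only [integral_const_mul]
    rfl
  · have hdom : Integrable (fun z : (Space d × Space d) × ℝ =>
        (‖u z.1.1 * v z.1.2‖ * μ.real Set.univ) * ‖κ (τ - z.2)‖) (volume.prod volume) :=
      ((integrable_prod_mul hui hvi).norm.mul_const _).mul_prod hκi.norm
    refine hdom.mono' ?_ (.of_forall fun z => ?_)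
    · have hm : Measurable (Function.uncurry fun (ζ : Space d × Space d) (s : ℝ) =>
          D.indicator (fun ζ => u ζ.1 * v ζ.2 * fourierMeasure μ ((c + δ * s) • ζ)) ζ) := by
        have : (Function.uncurry fun (ζ : Space d × Space d) (s : ℝ) =>
          D.indicator (fun ζ => u ζ.1 * v ζ.2 * fourierMeasure μ ((c + δ * s) • ζ)) ζ) =
          (Prod.fst ⁻¹' D).indicator fun z : (Space d × Space d) × ℝ =>
            u z.1.1 * v z.1.2 * fourierMeasure μ ((c + δ * z.2) • z.1) := by
          ext z
          simp only [Function.uncurry, Set.indicator]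
          rfl
        rw [this]
        have := continuous_fourierMeasure μ
        exact Measurable.indicator (Continuous.measurable (by fun_prop)) (measurable_fst hD)
      have h1 := κ.continuous
      exact ((Continuous.measurable (f := fun z : (Space d × Space d) × ℝ => κ (τ - z.2))
        (by fun_prop)).mul (hm.mul (Continuous.measurable
        (f := fun z : (Space d × Space d) × ℝ => expi ⟪x, z.1.1 + z.1.2⟫)
        (by fun_prop)))).aestronglyMeasurable
    · simp only [Function.uncurry]
      rw [norm_mul, norm_mul, norm_expi, mul_one, mul_comm]
      gcongr
      exact norm_piece_integrand_le _ _

end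

theorem lintegral_power_weight_lt_top {r : ℝ} (hr : 1 < r) (C : ℝ) :
    ∫⁻ v : ℝ, ENNReal.ofReal (C * (1 + |v|) ^ (-r)) < ⊤ := by
  have h : Integrable fun v : ℝ => C * (1 + ‖v‖) ^ (-r) :=
    (integrable_one_add_norm (μ := (volume : Measure ℝ)) (by simpa using hr)).const_mul C
  exact (h.lintegral_lt_top)

/-- The maximal estimate for one dyadic frequency scale `1 / δ`: the supremum over `E` costs the
number of intervals of length `δ` needed to cover `E`. -/
theorem exists_lintegral_iSup_frequencyPiece_sq_le {μ : Measure (Space d × Space d)}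
    [IsFiniteMeasure μ] (hμ : CompactlySupported μ) {a : ℝ}
    (ha : IsAdmissible a (fourierMeasure μ)) :
    ∃ K : ℝ≥0, ∀ (E : Set ℝ) (δ : ℝ) (s : Finset ℝ) (D : Set (Space d × Space d))
      (u v : Space d → ℂ), E ⊆ Set.Icc 1 2 → 0 < δ → δ ≤ 1 → E ⊆ ⋃ c ∈ s, Set.Icc c (c + δ) →
      MeasurableSet D → (∀ ζ ∈ D, ‖ζ‖ < δ⁻¹ ∧ (δ = 1 ∨ 1 ≤ 2 * (δ * ‖ζ‖))) →
      Continuous u → Continuous v → Integrable u → Integrable v →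
      ∫⁻ x, (⨆ t ∈ E, ‖frequencyPiece μ D u v t x‖ₑ) ^ 2 ≤
        K * s.card * ENNReal.ofReal (δ ^ (2 * a)) * volume (Metric.ball (0 : Space d) δ⁻¹) *
          ((∫⁻ ξ in Metric.ball (0 : Space d) δ⁻¹, ‖u ξ‖ₑ ^ 2) *
            ∫⁻ η in Metric.ball (0 : Space d) δ⁻¹, ‖v η‖ₑ ^ 2) := by
  obtain ⟨κ, hκ⟩ := exists_reproducing_kernel hμ
  obtain ⟨C, hC0, hC⟩ := ha.exists_norm_le
  -- The kernel weight `(1 + |v|)^{-N}` must stay integrable after absorbing the squared loss `(1 +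
  -- |v|)^{2a}`.
  obtain ⟨N, hN⟩ := exists_nat_gt (2 * a + 1)
  have ha0 : 0 < a := lt_of_le_of_lt (by positivity) ha.1
  obtain ⟨C', hC'0, hC'⟩ := exists_schwartz_translate_le κ N
  set k : ℝ → ℝ≥0∞ := fun v => ENNReal.ofReal (C' * (1 + |v|) ^ (-(N : ℝ))) with hk
  have hkm : Measurable k := by fun_prop
  have hk1 : ∫⁻ v, k v < ⊤ := lintegral_power_weight_lt_top (by linarith) C'
  have hk2 : ∫⁻ v, k v * ENNReal.ofReal ((1 + |v|) ^ a) ^ 2 < ⊤ := by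
    refine lt_of_eq_of_lt ?_ (lintegral_power_weight_lt_top (r := N - 2 * a) (by linarith) C')
    congr 1
    ext v
    have hv : 0 < 1 + |v| := by positivity
    rw [hk, ← ENNReal.ofReal_pow (by positivity), ← ENNReal.ofReal_mul (by positivity), mul_assoc,
      ← Real.rpow_natCast _ 2, ← Real.rpow_mul hv.le, ← Real.rpow_add hv]
    congr 3
    push_cast
    ring
  set K : ℝ≥0∞ := (∫⁻ v, k v) * ((∫⁻ v, k v * ENNReal.ofReal ((1 + |v|) ^ a) ^ 2) *
    ENNReal.ofReal C ^ 2) with hK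
  have hKtop : K ≠ ⊤ := ENNReal.mul_ne_top hk1.ne (ENNReal.mul_ne_top hk2.ne (by finiteness))
  refine ⟨K.toNNReal, fun E δ s D u v hE hδ hδ1 hs hD hDb hu hv hui hvi => ?_⟩
  rw [ENNReal.coe_toNNReal hKtop]
  set Q := volume (Metric.ball (0 : Space d) δ⁻¹) *
          ((∫⁻ ξ in Metric.ball (0 : Space d) δ⁻¹, ‖u ξ‖ₑ ^ 2) *
            ∫⁻ η in Metric.ball (0 : Space d) δ⁻¹, ‖v η‖ₑ ^ 2) with hQ
  have hcont := continuous_frequencyPiece (μ := μ) hD hu hv hui hvi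
  -- A majorant of the squared pieces for all `t ∈ [c, c + δ]` at once, built from fixed-time
  -- operators whose `L^2` norms are controlled.
  set P : ℝ → Space d → ℝ≥0∞ := fun c x =>
    (∫⁻ v, k v) * ∫⁻ s, k s * ‖frequencyPiece μ D u v (c + δ * s) x‖ₑ ^ 2 with hP
  have hjoint : ∀ c, Measurable fun z : Space d × ℝ =>
      k z.2 * ‖frequencyPiece μ D u v (c + δ * z.2) z.1‖ₑ ^ 2 := by
    intro c
    have h1 : Continuous fun z : Space d × ℝ => frequencyPiece μ D u v (c + δ * z.2) z.1 := by
      have h := hcont.comp (by fun_prop : Continuous fun z : Space d × ℝ => (c + δ * z.2, z.1))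
      exact h
    exact (hkm.comp measurable_snd).mul (h1.measurable.enorm.pow_const 2)
  have hPm : ∀ c, Measurable (P c) := fun c =>
    ((hjoint c).lintegral_prod_right' (ν := volume)).const_mul _
  have hpt : ∀ c t x, c ≤ t → t ≤ c + δ → ‖frequencyPiece μ D u v t x‖ₑ ^ 2 ≤ P c x := by
    intro c t x h1 h2
    obtain ⟨τ, hτ⟩ : ∃ τ, t = c + δ * τ := ⟨(t - c) / δ, by field_simp; ring⟩
    have hτ0 : 0 ≤ τ := by
      by_contra! h
      nlinarith
    have hτ1 : τ ≤ 1 := by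
      by_contra! h
      nlinarith
    have hx : Continuous fun s : ℝ => frequencyPiece μ D u v (c + δ * s) x := by
      have h := hcont.comp (by fun_prop : Continuous fun s : ℝ => (c + δ * s, x))
      exact h
    have h3 : ‖frequencyPiece μ D u v t x‖ₑ ≤
        ∫⁻ s, k s * ‖frequencyPiece μ D u v (c + δ * s) x‖ₑ := by
      rw [hτ, frequencyPiece_eq_integral (fun ζ hζ => hκ δ c τ ζ hδ ?_) hD hu hv hui hvi]
      · refine (enorm_integral_le_lintegral_enorm _).trans (lintegral_mono fun s => ?_)
        rw [enorm_mul]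
        gcongr
        rw [← ofReal_norm]
        exact ENNReal.ofReal_le_ofReal (hC' τ s hτ0 hτ1)
      · have := (hDb ζ hζ).1.le
        calc δ * ‖ζ‖ ≤ δ * δ⁻¹ := by gcongr
          _ = 1 := mul_inv_cancel₀ hδ.ne'
    exact (pow_le_pow_left' h3 2).trans
      (lintegral_weight_mul_sq_le volume hkm.aemeasurable hx.measurable.enorm.aemeasurable)
  have hPint : ∀ c, 1 - δ ≤ c → ∫⁻ x, P c x ≤ K * ENNReal.ofReal (δ ^ (2 * a)) * Q := by
    intro c hc
    have hL : ∀ s, ∫⁻ x, ‖frequencyPiece μ D u v (c + δ * s) x‖ₑ ^ 2 ≤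
        (ENNReal.ofReal C ^ 2 * ENNReal.ofReal (δ ^ (2 * a)) * Q) *
          ENNReal.ofReal ((1 + |s|) ^ a) ^ 2 := by
      intro s
      have h := lintegral_enorm_sumFourier_sq_le (R := δ⁻¹)
        (B := Real.toNNReal (C * δ ^ a * (1 + |s|) ^ a))
        (measurable_piece_integrand (μ := μ) hD hu hv (c + δ * s)) hu hv ?_ ?_
      · refine h.trans_eq ?_
        change ENNReal.ofReal _ ^ 2 * _ * _ = _
        rw [ENNReal.ofReal_mul (by positivity), ENNReal.ofReal_mul hC0, hQ, mul_pow, mul_pow,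
          ← ENNReal.ofReal_pow (by positivity : 0 ≤ δ ^ a), ← Real.rpow_natCast (δ ^ a),
          ← Real.rpow_mul hδ.le]
        push_cast
        rw [mul_comm a 2]
        ring
      · intro ζ
        by_cases hζ : ζ ∈ D
        · rw [Set.indicator_of_mem hζ, enorm_mul, enorm_mul, mul_comm]
          gcongr
          rw [← ofReal_norm]
          exact ENNReal.ofReal_le_ofReal (hC δ c s ζ hδ hδ1 hc (hDb ζ hζ).2)
        · simp [Set.indicator_of_notMem hζ]
      · intro ζ hζ
        have hmem : ζ ∈ D := Set.mem_of_indicator_ne_zero hζ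
        have := (hDb ζ hmem).1
        exact ⟨(norm_fst_le ζ).trans_lt this, (norm_snd_le ζ).trans_lt this⟩
    calc ∫⁻ x, P c x
        = (∫⁻ v, k v) * ∫⁻ x, ∫⁻ s, k s * ‖frequencyPiece μ D u v (c + δ * s) x‖ₑ ^ 2 := by
          rw [lintegral_const_mul' _ _ hk1.ne]
      _ = (∫⁻ v, k v) * ∫⁻ s, ∫⁻ x, k s * ‖frequencyPiece μ D u v (c + δ * s) x‖ₑ ^ 2 := by
          rw [lintegral_lintegral_swap (hjoint c).aemeasurable]
      _ = (∫⁻ v, k v) * ∫⁻ s, k s * ∫⁻ x, ‖frequencyPiece μ D u v (c + δ * s) x‖ₑ ^ 2 := by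
          congr 2
          ext s
          rw [lintegral_const_mul' _ _ ENNReal.ofReal_ne_top]
      _ ≤ (∫⁻ v, k v) * ∫⁻ s, k s * ((ENNReal.ofReal C ^ 2 * ENNReal.ofReal (δ ^ (2 * a)) * Q) *
          ENNReal.ofReal ((1 + |s|) ^ a) ^ 2) := by
          gcongr with s
          exact hL s
      _ = (∫⁻ v, k v) * ∫⁻ s, (ENNReal.ofReal C ^ 2 * ENNReal.ofReal (δ ^ (2 * a)) * Q) * (k s *
          ENNReal.ofReal ((1 + |s|) ^ a) ^ 2) := by
          congr 2
          ext s
          ring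
      _ = _ := by
          rw [lintegral_const_mul _ (by fun_prop), hK]
          ring
  -- A cover may contain intervals far to the left of `E`, where the decay estimate is unavailable.
  -- Any interval that meets `E ⊆ [1, 2]` has `c ≥ 1 - δ`.
  set s' := s.filter fun c => 1 - δ ≤ c with hs'
  have hsup : ∀ x, (⨆ t ∈ E, ‖frequencyPiece μ D u v t x‖ₑ) ^ 2 ≤ ∑ c ∈ s', P c x := by
    intro x
    refine iSup₂_sq_le fun t ht => ?_
    obtain ⟨c, hc, hct⟩ := Set.mem_iUnion₂.1 (hs ht)
    have hcs : c ∈ s' := Finset.mem_filter.2 ⟨hc, by linarith [(hE ht).1, hct.2]⟩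
    exact (hpt c t x hct.1 hct.2).trans
      (Finset.single_le_sum (f := fun c => P c x) (fun _ _ => bot_le) hcs)
  calc _ ≤ ∫⁻ x, ∑ c ∈ s', P c x := lintegral_mono hsup
    _ = ∑ c ∈ s', ∫⁻ x, P c x := lintegral_finsetSum _ fun c _ => hPm c
    _ ≤ ∑ c ∈ s', K * ENNReal.ofReal (δ ^ (2 * a)) * Q :=
        Finset.sum_le_sum fun c hc => hPint c (Finset.mem_filter.1 hc).2
    _ = s'.card * (K * ENNReal.ofReal (δ ^ (2 * a)) * Q) := by
        rw [Finset.sum_const, nsmul_eq_mul]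
    _ ≤ s.card * (K * ENNReal.ofReal (δ ^ (2 * a)) * Q) := by
        gcongr
        exact Finset.filter_subset _ _
    _ = _ := by rw [hQ]; ring

/-! ### Covering numbers and dyadic shells -/

theorem exists_cover_card_eq_coveringNumber {E : Set ℝ} (hE : E ⊆ Set.Icc 1 2) {δ : ℝ}
    (hδ : 0 < δ) :
    ∃ s : Finset ℝ, s.card = coveringNumber E δ ∧ E ⊆ ⋃ c ∈ s, Set.Icc c (c + δ) := by
  -- The infimum of the empty set in `ℕ` is `0`, so a finite cover must be exhibited before the
  -- infimum is known to be attained.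
  have hne : {n : ℕ | ∃ s : Finset ℝ, s.card = n ∧ E ⊆ ⋃ c ∈ s, Set.Icc c (c + δ)}.Nonempty := by
    obtain ⟨t, -, htf, ht⟩ := (isCompact_Icc (a := (1 : ℝ)) (b := 2)).finite_cover_balls
      (half_pos hδ)
    refine ⟨_, htf.toFinset.image (fun x => x - δ / 2), rfl, fun y hy => ?_⟩
    obtain ⟨x, hx, hxy⟩ := Set.mem_iUnion₂.1 (ht (hE hy))
    rw [Metric.mem_ball, Real.dist_eq, abs_lt] at hxy
    refine Set.mem_iUnion₂.2 ⟨x - δ / 2, Finset.mem_image_of_mem _ (htf.mem_toFinset.2 hx), ?_⟩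
    constructor <;> linarith [hxy.1, hxy.2]
  exact Nat.sInf_mem hne

/-- Dyadic covering numbers grow at most like `2^{jb}` for every `b` above the upper Minkowski
dimension. -/
theorem exists_coveringNumber_le {E : Set ℝ} {β b : ℝ} (hβ : upperMinkowskiDim E = (β : EReal))
    (hb : β < b) :
    ∃ C : ℝ, ∀ j : ℕ, (coveringNumber E ((2 : ℝ)⁻¹ ^ j) : ℝ) ≤ C * (2 : ℝ) ^ (b * j) := by
  have h1 : ∀ᶠ δ : ℝ in 𝓝[>] 0,
      ((Real.log (coveringNumber E δ) / Real.log (1 / δ) : ℝ) : EReal) < (b : EReal) := by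
    refine eventually_lt_of_limsup_lt ?_
    change upperMinkowskiDim E < _
    rw [hβ]
    exact_mod_cast hb
  have h2 : Tendsto (fun j : ℕ => (2 : ℝ)⁻¹ ^ j) atTop (𝓝[>] 0) :=
    tendsto_nhdsWithin_iff.2 ⟨tendsto_pow_atTop_nhds_zero_of_lt_one (by norm_num) (by norm_num),
      .of_forall fun j => by simp⟩
  have h3 : ∀ᶠ j : ℕ in atTop,
      (coveringNumber E ((2 : ℝ)⁻¹ ^ j) : ℝ) * (2 : ℝ) ^ (-(b * j)) ≤ 1 := by
    filter_upwards [h2.eventually h1, eventually_gt_atTop 0] with j hj hj0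
    rw [EReal.coe_lt_coe_iff] at hj
    rcases Nat.eq_zero_or_pos (coveringNumber E ((2 : ℝ)⁻¹ ^ j)) with h0 | h0
    · rw [h0]; simp
    have hlog : Real.log (1 / (2 : ℝ)⁻¹ ^ j) = j * Real.log 2 := by
      rw [one_div, inv_pow, inv_inv, Real.log_pow]
    have hl2 : 0 < Real.log 2 := Real.log_pos (by norm_num)
    have hj0' : (0 : ℝ) < j := by exact_mod_cast hj0
    rw [hlog, div_lt_iff₀ (by positivity)] at hj
    have hN : (0 : ℝ) < coveringNumber E ((2 : ℝ)⁻¹ ^ j) := by exact_mod_cast h0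
    have h4 : (coveringNumber E ((2 : ℝ)⁻¹ ^ j) : ℝ) ≤ (2 : ℝ) ^ (b * j) := by
      rw [Real.rpow_def_of_pos (by norm_num), ← Real.log_le_iff_le_exp hN]
      linarith
    calc _ ≤ (2 : ℝ) ^ (b * j) * (2 : ℝ) ^ (-(b * j)) := by gcongr
      _ = 1 := by rw [← Real.rpow_add (by norm_num)]; simp
  -- The bound `1` holds for large `j`; the finitely many remaining scales only enlarge the
  -- constant.
  have h5 : BddAbove (Set.range fun j : ℕ =>
      (coveringNumber E ((2 : ℝ)⁻¹ ^ j) : ℝ) * (2 : ℝ) ^ (-(b * j))) :=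
    IsBoundedUnder.bddAbove_range ⟨1, by simpa using h3⟩
  obtain ⟨C, hC⟩ := h5
  refine ⟨C, fun j => ?_⟩
  have := hC ⟨j, rfl⟩
  dsimp only at this
  rwa [Real.rpow_neg (by norm_num), ← div_eq_mul_inv, div_le_iff₀ (by positivity)] at this

/-- The dyadic decomposition of the frequency space. -/
def dyadicShell (d j : ℕ) : Set (Space d × Space d) :=
  {ζ | ‖ζ‖ < 2 ^ j ∧ (j = 0 ∨ 2 ^ j ≤ 2 * ‖ζ‖)}

theorem measurableSet_dyadicShell (d j : ℕ) : MeasurableSet (dyadicShell d j) := by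
  have h1 : MeasurableSet {ζ : Space d × Space d | ‖ζ‖ < 2 ^ j} :=
    measurableSet_lt measurable_norm measurable_const
  have h2 : MeasurableSet {ζ : Space d × Space d | (2 : ℝ) ^ j ≤ 2 * ‖ζ‖} :=
    measurableSet_le measurable_const (measurable_norm.const_mul _)
  exact h1.inter ((MeasurableSet.const _).union h2)

theorem pairwise_disjoint_dyadicShell (d : ℕ) :
    Pairwise (Function.onFun Disjoint (dyadicShell d)) := by
  have key : ∀ i j, i < j → Disjoint (dyadicShell d i) (dyadicShell d j) := by
    intro i j hij
    rw [Set.disjoint_left]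
    rintro ζ ⟨h1, -⟩ ⟨-, h2⟩
    rcases h2 with h2 | h2
    · omega
    · obtain ⟨k, rfl⟩ : ∃ k, j = k + 1 := ⟨j - 1, by omega⟩
      have h3 : (2 : ℝ) ^ i ≤ 2 ^ k := pow_le_pow_right₀ (by norm_num) (by omega)
      rw [pow_succ] at h2
      linarith
  intro i j hij
  rcases lt_or_gt_of_ne hij with h | h
  · exact key i j h
  · exact (key j i h).symm

theorem iUnion_dyadicShell (d : ℕ) : ⋃ j, dyadicShell d j = Set.univ := by
  refine Set.eq_univ_of_forall fun ζ => Set.mem_iUnion.2 ?_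
  have hex : ∃ j : ℕ, ‖ζ‖ < 2 ^ j := pow_unbounded_of_one_lt _ (by norm_num)
  classical
  refine ⟨Nat.find hex, Nat.find_spec hex, ?_⟩
  rcases Nat.eq_zero_or_pos (Nat.find hex) with h | h
  · exact Or.inl h
  · right
    have := Nat.find_min hex (Nat.sub_lt h one_pos)
    obtain ⟨k, hk⟩ : ∃ k, Nat.find hex = k + 1 := ⟨Nat.find hex - 1, by omega⟩
    rw [hk] at this ⊢
    simp only [add_tsub_cancel_right, not_lt] at this
    rw [pow_succ]
    linarith

theorem enorm_frequencyPiece_univ_le {μ : Measure (Space d × Space d)} [IsFiniteMeasure μ]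
    {u v : Space d → ℂ} (hu : Continuous u) (hv : Continuous v) (hui : Integrable u)
    (hvi : Integrable v) (t : ℝ) (x : Space d) :
    ‖frequencyPiece μ Set.univ u v t x‖ₑ ≤
      ∑' j, ‖frequencyPiece μ (dyadicShell d j) u v t x‖ₑ := by
  set G : Space d × Space d → ℂ := fun ζ =>
    u ζ.1 * v ζ.2 * fourierMeasure μ (t • ζ) * expi ⟪x, ζ.1 + ζ.2⟫ with hG
  have hm := continuous_fourierMeasure μ
  have hGi : Integrable G := by
    refine ((integrable_prod_mul hui hvi).norm.mul_const (μ.real Set.univ)).mono'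
      (Continuous.aestronglyMeasurable (by fun_prop)) (.of_forall fun ζ => ?_)
    rw [hG, norm_mul, norm_mul, norm_expi, mul_one]
    gcongr
    exact norm_fourierMeasure_le μ _
  have hpiece : ∀ D, MeasurableSet D → frequencyPiece μ D u v t x = ∫ ζ in D, G ζ := by
    intro D hD
    rw [← integral_indicator hD]
    unfold frequencyPiece sumFourier
    congr 1
    ext ζ
    by_cases hζ : ζ ∈ D <;> simp [hζ, hG]
  rw [hpiece _ MeasurableSet.univ, ← iUnion_dyadicShell d,
    integral_iUnion (measurableSet_dyadicShell d) (pairwise_disjoint_dyadicShell d)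
      hGi.integrableOn]
  simp only [hpiece _ (measurableSet_dyadicShell d _)]
  exact enorm_tsum_le_tsum_enorm

/-! ### Summation over scales: the `L^2` bound on test functions -/

theorem tsum_weight_mul_sq_le (ρ b : ℕ → ℝ≥0∞) :
    (∑' j, ρ j * b j) ^ 2 ≤ (∑' j, ρ j) * ∑' j, ρ j * b j ^ 2 := by
  have h := lintegral_weight_mul_sq_le Measure.count (k := ρ) (f := b)
    (by fun_prop) (by fun_prop)
  simpa only [lintegral_count] using h

theorem IsTestFunction.exists_schwartz {f : Space d → ℂ} (hf : IsTestFunction f) :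
    ∃ φ : SchwartzMap (Space d) ℂ, ⇑φ = f := ⟨hf.2.toSchwartzMap hf.1, rfl⟩

theorem bilinearMultiplier_eq_frequencyPiece (μ : Measure (Space d × Space d)) (f g : Space d → ℂ)
    (t : ℝ) (x : Space d) :
    bilinearMultiplier (fun ζ => fourierMeasure μ (t • ζ.1, t • ζ.2)) f g x =
      frequencyPiece μ Set.univ (𝓕 f) (𝓕 g) t x := by
  unfold bilinearMultiplier frequencyPiece sumFourier
  simp only [Set.indicator_univ]
  rfl

/-- Collects the powers of `2^j`: covering number, decay of `μ̂`, volume of the ball, and the two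
`L^p` losses. -/
theorem dyadic_exponent_identity (a b θ p q : ℝ) (d j : ℕ)
    (hθ : b - 2 * a + d + d * (2 / p - 1) + d * (2 / q - 1) = -(2 * θ)) :
    (2 : ℝ) ^ (b * j) * ((2 : ℝ)⁻¹ ^ j) ^ (2 * a) * (((2 : ℝ)⁻¹ ^ j)⁻¹ ^ d *
      ((((2 : ℝ)⁻¹ ^ j)⁻¹) ^ (d * (2 / p - 1)) * (((2 : ℝ)⁻¹ ^ j)⁻¹) ^ (d * (2 / q - 1)))) =
      (((2 : ℝ) ^ (-θ)) ^ j) ^ 2 := by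
  obtain ⟨L, hL⟩ : ∃ L, (2 : ℝ) = Real.exp L := ⟨_, (Real.exp_log two_pos).symm⟩
  have e : ∀ s : ℝ, Real.exp L ^ s = Real.exp (L * s) := fun s => (Real.exp_mul L s).symm
  rw [← Real.rpow_natCast (_⁻¹) d, hL]
  simp only [← Real.exp_neg, ← Real.exp_nat_mul, ← Real.exp_add, ← Real.exp_mul]
  congr 1
  rw [← hL]
  push_cast
  linear_combination (L * j) * hθ

/-- Since `E` may be uncountable, measurability comes from lower semicontinuity of a supremum of
continuous functions. -/
theorem measurable_biSup_of_continuous {X : Type*} [TopologicalSpace X] [MeasurableSpace X]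
    [BorelSpace X] (E : Set ℝ) {F : ℝ → X → ℂ} (hF : ∀ t ∈ E, Continuous (F t)) :
    Measurable fun x => ⨆ t ∈ E, ‖F t x‖ₑ :=
  (lowerSemicontinuous_biSup fun t ht => (hF t ht).enorm.lowerSemicontinuous).measurable

/-- The maximal operator is bounded `L^p × L^q → L^2` on test functions. -/
theorem exists_lintegral_maximalMultiplier_sq_le (hd : 1 ≤ d)
    {μ : Measure (Space d × Space d)} [IsFiniteMeasure μ] (hμ : CompactlySupported μ)
    {E : Set ℝ} (hE : E ⊆ Set.Icc 1 2) {β : ℝ} (hβ : upperMinkowskiDim E = (β : EReal))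
    {a : ℝ} (ha : IsAdmissible a (fourierMeasure μ)) {p q : ℝ} (hp1 : 1 ≤ p) (hp2 : p ≤ 2)
    (hq1 : 1 ≤ q) (hq2 : q ≤ 2) (hpq : 1 / p + 1 / q < 1 / 2 + (2 * a - β) / (2 * d)) :
    ∃ K : ℝ≥0, ∀ f g : Space d → ℂ, IsTestFunction f → IsTestFunction g →
      ∫⁻ x, maximalMultiplier (fourierMeasure μ) E f g x ^ 2 ≤
        K * ((∫⁻ x, ‖f x‖ₑ ^ p) ^ (2 / p) * (∫⁻ x, ‖g x‖ₑ ^ q) ^ (2 / q)) := by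
  have hd0 : (0 : ℝ) < d := by exact_mod_cast hd
  -- The available gap in the exponent is `4θ`. Half of it is spent on using `β + 2θ` instead of `β`
  -- for the covering numbers; the other half leaves the decay `2^{-2θj}`.
  obtain ⟨θ, hθ, hθ0⟩ : ∃ θ, 4 * θ = 2 * a - β + d - 2 * d * (1 / p + 1 / q) ∧ 0 < θ := by
    refine ⟨(2 * a - β + d - 2 * d * (1 / p + 1 / q)) / 4, by ring, ?_⟩
    have h := mul_lt_mul_of_pos_left hpq (by positivity : 0 < 2 * (d : ℝ))
    have e : 2 * (d : ℝ) * (1 / 2 + (2 * a - β) / (2 * d)) = d + (2 * a - β) := by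
      field_simp
    rw [e] at h
    linarith
  obtain ⟨C, hC⟩ := exists_coveringNumber_le hβ (show β < β + 2 * θ by linarith)
  obtain ⟨K, hK⟩ := exists_lintegral_iSup_frequencyPiece_sq_le hμ ha
  set V := volume (Metric.ball (0 : Space d) 1) with hV
  have hVtop : V ≠ ⊤ := measure_ball_lt_top.ne
  set σ : ℝ := (2 : ℝ) ^ (-θ) with hσ
  have hσ1 : σ < 1 := Real.rpow_lt_one_of_one_lt_of_neg (by norm_num) (by linarith)
  have hσ0 : 0 < σ := by positivity
  set ρ : ℕ → ℝ≥0∞ := fun j => ENNReal.ofReal σ ^ j with hρ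
  have hρsum : ∑' j, ρ j ≠ ⊤ := by
    rw [hρ, ENNReal.tsum_geometric]
    have : ENNReal.ofReal σ < 1 := by simpa using hσ1
    simpa [tsub_eq_zero_iff_le] using this
  set M : ℝ≥0∞ := K * ENNReal.ofReal C * (V * (2 * (V + 1)) * (2 * (V + 1))) with hM
  have hMtop : M ≠ ⊤ := by finiteness
  refine ⟨((∑' j, ρ j) * ((∑' j, ρ j) * M)).toNNReal, fun f g hf hg => ?_⟩
  rw [ENNReal.coe_toNNReal (ENNReal.mul_ne_top hρsum (ENNReal.mul_ne_top hρsum hMtop))]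
  obtain ⟨φ, rfl⟩ := hf.exists_schwartz
  obtain ⟨ψ, rfl⟩ := hg.exists_schwartz
  set F := (∫⁻ x, ‖φ x‖ₑ ^ p) ^ (2 / p) with hF
  set G := (∫⁻ x, ‖ψ x‖ₑ ^ q) ^ (2 / q) with hG
  have huc : Continuous (𝓕 (φ : Space d → ℂ)) := by
    rw [← SchwartzMap.fourier_coe]; exact SchwartzMap.continuous _
  have hvc : Continuous (𝓕 (ψ : Space d → ℂ)) := by
    rw [← SchwartzMap.fourier_coe]; exact SchwartzMap.continuous _
  have hui : Integrable (𝓕 (φ : Space d → ℂ)) := by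
    rw [← SchwartzMap.fourier_coe]; exact SchwartzMap.integrable _
  have hvi : Integrable (𝓕 (ψ : Space d → ℂ)) := by
    rw [← SchwartzMap.fourier_coe]; exact SchwartzMap.integrable _
  set b : ℕ → Space d → ℝ≥0∞ := fun j x =>
    ⨆ t ∈ E, ‖frequencyPiece μ (dyadicShell d j) (𝓕 (φ : Space d → ℂ)) (𝓕 (ψ : Space d → ℂ)) t x‖ₑ
    with hb
  have hbm : ∀ j, Measurable (b j) := by
    intro j
    have hcont := continuous_frequencyPiece (μ := μ) (measurableSet_dyadicShell d j) huc hvc hui hvi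
    refine measurable_biSup_of_continuous E fun t _ => ?_
    have h := hcont.comp (by fun_prop : Continuous fun x : Space d => (t, x))
    exact h
  have hbj : ∀ j, ∫⁻ x, b j x ^ 2 ≤ M * (F * G) * ρ j ^ 2 := by
    intro j
    set δ : ℝ := (2 : ℝ)⁻¹ ^ j with hδ
    have hδ0 : 0 < δ := by positivity
    have hδinv : δ⁻¹ = 2 ^ j := by rw [hδ, inv_pow, inv_inv]
    obtain ⟨s, hs, hcov⟩ := exists_cover_card_eq_coveringNumber hE hδ0
    have h := hK E δ s (dyadicShell d j) _ _ hE hδ0 (pow_le_one₀ (by norm_num) (by norm_num)) hcov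
      (measurableSet_dyadicShell d j) (fun ζ hζ => ⟨by rw [hδinv]; exact hζ.1, ?_⟩) huc hvc hui hvi
    · refine h.trans ?_
      have hcard : (s.card : ℝ≥0∞) ≤ ENNReal.ofReal C * ENNReal.ofReal (2 ^ ((β + 2 * θ) * j)) := by
        rw [← ENNReal.ofReal_mul' (by positivity), ← ENNReal.ofReal_natCast, hs]
        exact ENNReal.ofReal_le_ofReal (hC j)
      have hU := lintegral_ball_enorm_fourier_sq_le hd hp1 hp2 φ.continuous.measurable φ.integrable
        (φ.memLp 2) (inv_pos.2 hδ0)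
      have hW := lintegral_ball_enorm_fourier_sq_le hd hq1 hq2 ψ.continuous.measurable ψ.integrable
        (ψ.memLp 2) (inv_pos.2 hδ0)
      rw [volume_ball_eq hd (inv_pos.2 hδ0).le]
      calc _ ≤ K * (ENNReal.ofReal C * ENNReal.ofReal (2 ^ ((β + 2 * θ) * j))) *
            ENNReal.ofReal (δ ^ (2 * a)) * (ENNReal.ofReal (δ⁻¹ ^ d) * V) *
            ((2 * (V + 1) * ENNReal.ofReal (δ⁻¹ ^ (d * (2 / p - 1))) * F) *
              (2 * (V + 1) * ENNReal.ofReal (δ⁻¹ ^ (d * (2 / q - 1))) * G)) := by gcongr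
        _ = M * (F * G) * (ENNReal.ofReal (2 ^ ((β + 2 * θ) * j)) * ENNReal.ofReal (δ ^ (2 * a)) *
            (ENNReal.ofReal (δ⁻¹ ^ d) * (ENNReal.ofReal (δ⁻¹ ^ (d * (2 / p - 1))) *
              ENNReal.ofReal (δ⁻¹ ^ (d * (2 / q - 1)))))) := by
            rw [hM]; ring
        _ = M * (F * G) * ρ j ^ 2 := by
            rw [← ENNReal.ofReal_mul (by positivity), ← ENNReal.ofReal_mul (by positivity),
              ← ENNReal.ofReal_mul (by positivity), ← ENNReal.ofReal_mul (by positivity),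
              show ρ j = ENNReal.ofReal σ ^ j from rfl, ← ENNReal.ofReal_pow hσ0.le,
              ← ENNReal.ofReal_pow (by positivity), hδ,
              dyadic_exponent_identity a (β + 2 * θ) θ p q d j]
            linear_combination hθ
    · rcases hζ.2 with h0 | h0
      · left; simp [hδ, h0]
      · right
        rw [← hδinv] at h0
        calc (1 : ℝ) = δ * δ⁻¹ := (mul_inv_cancel₀ hδ0.ne').symm
          _ ≤ δ * (2 * ‖ζ‖) := by gcongr
          _ = _ := by ring
  have hpt : ∀ x, maximalMultiplier (fourierMeasure μ) E φ ψ x ≤ ∑' j, b j x := by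
    intro x
    refine iSup₂_le fun t ht => ?_
    rw [bilinearMultiplier_eq_frequencyPiece]
    refine (enorm_frequencyPiece_univ_le huc hvc hui hvi t x).trans
      (ENNReal.tsum_le_tsum fun j => ?_)
    exact le_iSup₂ (f := fun t (_ : t ∈ E) => ‖frequencyPiece μ (dyadicShell d j)
      (𝓕 (φ : Space d → ℂ)) (𝓕 (ψ : Space d → ℂ)) t x‖ₑ) t ht
  have hρ0 : ∀ j, ρ j ≠ 0 := fun j => pow_ne_zero _ (by simpa using hσ0)
  have hρt : ∀ j, ρ j ≠ ⊤ := fun j => by rw [hρ]; finiteness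
  -- With the weights `ρ j = 2^{-θj}`, Cauchy-Schwarz bounds `(∑ b_j)^2` by `∑ ρ_j` times `∑ ρ_j
  -- (b_j / ρ_j)^2`. The integral of `b_j^2` decays like `ρ_j^2`, so both sums are geometric.
  calc ∫⁻ x, maximalMultiplier (fourierMeasure μ) E φ ψ x ^ 2
      ≤ ∫⁻ x, (∑' j, ρ j) * ∑' j, ρ j * ((ρ j)⁻¹ * b j x) ^ 2 := by
        refine lintegral_mono fun x => ?_
        refine le_trans ?_ (tsum_weight_mul_sq_le ρ fun j => (ρ j)⁻¹ * b j x)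
        refine pow_le_pow_left' ((hpt x).trans_eq (tsum_congr fun j => ?_)) 2
        rw [← mul_assoc, ENNReal.mul_inv_cancel (hρ0 j) (hρt j), one_mul]
    _ = (∑' j, ρ j) * ∑' j, ρ j * ((ρ j)⁻¹ ^ 2 * ∫⁻ x, b j x ^ 2) := by
        rw [lintegral_const_mul' _ _ hρsum, lintegral_tsum fun j =>
          ((((hbm j).const_mul _).pow_const 2).const_mul _).aemeasurable]
        congr 2
        ext j
        simp only [mul_pow]
        rw [lintegral_const_mul _ (((hbm j).pow_const 2).const_mul _),
          lintegral_const_mul _ ((hbm j).pow_const 2)]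
    _ ≤ (∑' j, ρ j) * ∑' j, ρ j * ((ρ j)⁻¹ ^ 2 * (M * (F * G) * ρ j ^ 2)) := by
        gcongr with j
        exact hbj j
    _ = (∑' j, ρ j) * ∑' j, ρ j * (M * (F * G)) := by
        congr 2
        ext j
        rw [mul_comm _ (ρ j ^ 2), ← mul_assoc ((ρ j)⁻¹ ^ 2), ← mul_pow,
          ENNReal.inv_mul_cancel (hρ0 j) (hρt j), one_pow, one_mul]
    _ = _ := by rw [ENNReal.tsum_mul_right]; ring

/-! ### From multipliers to averages, and from test functions to `L^p` -/

/-- Fourier inversion identifies the multiplier operator of `μ̂` with the bilinear average. -/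
theorem bilinearMultiplier_eq_bilinearAverage (μ : Measure (Space d × Space d)) [IsFiniteMeasure μ]
    {f g : Space d → ℂ} (hf : IsTestFunction f) (hg : IsTestFunction g) (t : ℝ) (x : Space d) :
    bilinearMultiplier (fun ζ => fourierMeasure μ (t • ζ.1, t • ζ.2)) f g x =
      bilinearAverage μ t f g x := by
  obtain ⟨φ, rfl⟩ := hf.exists_schwartz
  obtain ⟨ψ, rfl⟩ := hg.exists_schwartz
  have inv : ∀ (φ : SchwartzMap (Space d) ℂ) (y : Space d),
      ∫ ξ, 𝓕 (φ : Space d → ℂ) ξ * expi ⟪y, ξ⟫ = φ y := by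
    intro φ y
    have h : 𝓕⁻ (𝓕 φ) y = φ y := by rw [FourierTransform.fourierInv_fourier_eq]
    rw [← h, SchwartzMap.fourierInv_coe, Real.fourierInv_eq', ← SchwartzMap.fourier_coe]
    congr 1
    ext ξ
    rw [smul_eq_mul, mul_comm, expi, real_inner_comm]
  have hui : Integrable (𝓕 (φ : Space d → ℂ)) := by
    rw [← SchwartzMap.fourier_coe]; exact SchwartzMap.integrable _
  have hvi : Integrable (𝓕 (ψ : Space d → ℂ)) := by
    rw [← SchwartzMap.fourier_coe]; exact SchwartzMap.integrable _
  have e1 : bilinearMultiplier (fun ζ => fourierMeasure μ (t • ζ.1, t • ζ.2)) φ ψ x =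
      ∫ ζ : Space d × Space d, ∫ w, (𝓕 (φ : Space d → ℂ) ζ.1 * expi ⟪x - t • w.1, ζ.1⟫) *
        (𝓕 (ψ : Space d → ℂ) ζ.2 * expi ⟪x - t • w.2, ζ.2⟫) ∂μ := by
    unfold bilinearMultiplier
    congr 1
    ext ζ
    have h1 : fourierMeasure μ (t • ζ.1, t • ζ.2) = fourierMeasure μ (t • ζ) := rfl
    dsimp only
    rw [h1, fourierMeasure_eq, ← integral_const_mul, ← integral_mul_const]
    congr 1
    ext w
    change _ * expi _ * expi _ = _
    rw [mul_assoc, ← expi_add, mul_mul_mul_comm, ← expi_add]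
    congr 2
    rw [phase_smul]
    simp only [phase, inner_add_right, inner_sub_left, inner_smul_left]
    simp
    ring
  rw [e1, integral_integral_swap]
  · unfold bilinearAverage
    congr 1
    ext w
    rw [← inv φ, ← inv ψ, Measure.volume_eq_prod]
    exact integral_prod_mul (fun ξ => 𝓕 (φ : Space d → ℂ) ξ * expi ⟪x - t • w.1, ξ⟫)
      (fun ξ => 𝓕 (ψ : Space d → ℂ) ξ * expi ⟪x - t • w.2, ξ⟫)
  · have h := (integrable_prod_mul hui hvi).comp_fst μ
    refine h.mono ?_ (.of_forall fun z => ?_)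
    · have h1 : Continuous (𝓕 (φ : Space d → ℂ)) := by
        rw [← SchwartzMap.fourier_coe]; exact SchwartzMap.continuous _
      have h2 : Continuous (𝓕 (ψ : Space d → ℂ)) := by
        rw [← SchwartzMap.fourier_coe]; exact SchwartzMap.continuous _
      unfold Function.uncurry
      exact Continuous.aestronglyMeasurable (by fun_prop)
    · simp [Function.uncurry, norm_expi]

/-- A nonnegative lower semicontinuous function on a locally compact second countable space is the
supremum of an increasing sequence of compactly supported continuous functions. -/
theorem exists_monotone_seq_iSup_eq_of_lowerSemicontinuous {X : Type*} [TopologicalSpace X]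
    [RegularSpace X] [LocallyCompactSpace X] [SecondCountableTopology X] {H : X → ℝ≥0∞}
    (hH : LowerSemicontinuous H) :
    ∃ φ : ℕ → X → ℝ≥0, Monotone φ ∧ (∀ n, Continuous (φ n)) ∧ (∀ n, HasCompactSupport (φ n)) ∧
      ∀ x, ⨆ n, (φ n x : ℝ≥0∞) = H x := by
  set S : Set (X → ℝ≥0∞) := {h | ∃ φ : X → ℝ≥0, Continuous φ ∧ HasCompactSupport φ ∧
    h = (fun x => (φ x : ℝ≥0∞)) ∧ h ≤ H} with hS
  have hlub : IsLUB S H := by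
    refine ⟨fun h hh => hh.choose_spec.2.2.2, fun B hB x => ?_⟩
    refine ENNReal.le_of_forall_nnreal_lt fun c hc => ?_
    have hU : IsOpen {y | (c : ℝ≥0∞) < H y} := hH.isOpen_preimage c
    obtain ⟨f, hf1, hf0, hfc, hf⟩ := exists_continuous_one_zero_of_isCompact
      (isCompact_singleton (x := x)) hU.isClosed_compl
      (Set.disjoint_singleton_left.2 fun h => h hc)
    have hmem : (fun y => ((c * (f y).toNNReal : ℝ≥0) : ℝ≥0∞)) ∈ S := by
      refine ⟨fun y => c * (f y).toNNReal, by fun_prop, ?_, rfl, fun y => ?_⟩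
      · exact (hfc.comp_left Real.toNNReal_zero).mul_left
      · by_cases hy : (c : ℝ≥0∞) < H y
        · refine le_trans ?_ hy.le
          rw [ENNReal.coe_le_coe]
          exact mul_le_of_le_one_right' (Real.toNNReal_le_one.2 (hf y).2)
        · have : f y = 0 := hf0 hy
          simp [this]
    have h1 : f x = 1 := hf1 rfl
    simpa [h1] using hB hmem x
  -- Urysohn functions below `H` have supremum `H`; second countability leaves a countable
  -- subfamily, and its partial suprema form the increasing sequence. Inserting `0` makes the family
  -- nonempty, so that it can be enumerated.
  obtain ⟨S', hS'S, hS'c, hS'⟩ := exists_countable_lowerSemicontinuous_isLUB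
    (fun h (hh : h ∈ S) => by
      obtain ⟨φ, hφ, -, rfl, -⟩ := hh
      exact (ENNReal.continuous_coe.comp hφ).lowerSemicontinuous) hlub
  obtain ⟨e, he⟩ := (hS'c.insert 0).exists_eq_range (Set.insert_nonempty _ _)
  have heS : ∀ n, e n ∈ S := by
    intro n
    have : e n ∈ insert 0 S' := he ▸ Set.mem_range_self n
    rcases this with h | h
    · exact ⟨0, continuous_const, HasCompactSupport.zero, by rw [h]; ext; simp,
        by rw [h]; exact fun _ => bot_le⟩
    · exact hS'S h
  choose ψ hψc hψs hψe hψH using heS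
  refine ⟨partialSups ψ, (partialSups ψ).monotone, fun n => Continuous.partialSups fun k _ => hψc k,
    fun n => ?_, fun x => le_antisymm (iSup_le fun n => ?_) ?_⟩
  · induction n with
    | zero => simpa using hψs 0
    | succ n ih =>
      rw [partialSups_add_one]
      refine (ih.isCompact.union (hψs (n + 1)).isCompact).of_isClosed_subset
        (isClosed_tsupport _) (closure_minimal (fun y hy => ?_)
          ((isClosed_tsupport _).union (isClosed_tsupport _)))
      by_contra hcon
      rw [Set.mem_union, not_or] at hcon
      have h1 := image_eq_zero_of_notMem_tsupport hcon.1
      have h2 := image_eq_zero_of_notMem_tsupport hcon.2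
      exact hy (by simp [h1, h2])
  · rw [Pi.partialSups_apply]
    obtain ⟨j, -, hj⟩ := exists_partialSups_eq (fun k => ψ k x) n
    rw [hj]
    have := hψH j x
    rwa [hψe j] at this
  · have hub : (fun x => ⨆ n, ((partialSups ψ n x : ℝ≥0) : ℝ≥0∞)) ∈ upperBounds S' := by
      intro h hh y
      have hmem : h ∈ Set.range e := he ▸ Set.mem_insert_of_mem _ hh
      obtain ⟨n, rfl⟩ := hmem
      refine le_trans ?_ (le_iSup _ n)
      rw [hψe n, ENNReal.coe_le_coe]
      exact le_partialSups ψ n y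
    exact hS'.2 hub x

/-- The maximal average of nonnegative functions. -/
def posMax (μ : Measure (Space d × Space d)) (E : Set ℝ) (f g : Space d → ℝ≥0∞) (x : Space d) :
    ℝ≥0∞ :=
  ⨆ t ∈ E, ∫⁻ w, f (x - t • w.1) * g (x - t • w.2) ∂μ

theorem posMax_mono (μ : Measure (Space d × Space d)) (E : Set ℝ) {f f' g g' : Space d → ℝ≥0∞}
    (hf : ∀ x, f x ≤ f' x) (hg : ∀ x, g x ≤ g' x) (x : Space d) :
    posMax μ E f g x ≤ posMax μ E f' g' x := by
  unfold posMax
  gcongr with t ht w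
  · exact hf _
  · exact hg _

theorem maximalAverage_le_posMax (μ : Measure (Space d × Space d)) (E : Set ℝ)
    (f g : Space d → ℂ) (x : Space d) :
    maximalAverage μ E f g x ≤ posMax μ E (fun y => ‖f y‖ₑ) (fun y => ‖g y‖ₑ) x := by
  unfold maximalAverage posMax bilinearAverage
  gcongr with t ht
  refine (enorm_integral_le_lintegral_enorm _).trans_eq ?_
  simp only [enorm_mul]

section CompactSupport

variable {μ : Measure (Space d × Space d)} [IsFiniteMeasure μ] {E : Set ℝ}

theorem integrable_average {f g : Space d → ℂ} (hf : Continuous f) (hfc : HasCompactSupport f)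
    (hg : Continuous g) (hgc : HasCompactSupport g) (t : ℝ) (x : Space d) :
    Integrable (fun w : Space d × Space d => f (x - t • w.1) * g (x - t • w.2)) μ := by
  obtain ⟨A, hA⟩ := hfc.exists_bound_of_continuous hf
  obtain ⟨B, hB⟩ := hgc.exists_bound_of_continuous hg
  refine Integrable.of_bound (C := A * B) (Continuous.aestronglyMeasurable (by fun_prop))
    (.of_forall fun w => ?_)
  rw [norm_mul]
  exact mul_le_mul (hA _) (hB _) (norm_nonneg _) ((norm_nonneg _).trans (hA 0))

theorem continuous_bilinearAverage {f g : Space d → ℂ} (hf : Continuous f)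
    (hfc : HasCompactSupport f) (hg : Continuous g) (hgc : HasCompactSupport g) (t : ℝ) :
    Continuous (bilinearAverage μ t f g) := by
  obtain ⟨A, hA⟩ := hfc.exists_bound_of_continuous hf
  obtain ⟨B, hB⟩ := hgc.exists_bound_of_continuous hg
  refine continuous_of_dominated (bound := fun _ => A * B)
    (fun x => (integrable_average hf hfc hg hgc t x).aestronglyMeasurable)
    (fun x => .of_forall fun w => ?_) (integrable_const _) (.of_forall fun w => by fun_prop)
  rw [norm_mul]
  exact mul_le_mul (hA _) (hB _) (norm_nonneg _) ((norm_nonneg _).trans (hA 0))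

theorem measurable_maximalAverage {f g : Space d → ℂ} (hf : Continuous f)
    (hfc : HasCompactSupport f) (hg : Continuous g) (hgc : HasCompactSupport g) :
    Measurable (maximalAverage μ E f g) :=
  measurable_biSup_of_continuous E fun t _ => continuous_bilinearAverage hf hfc hg hgc t

theorem posMax_coe_eq_maximalAverage {φ ψ : Space d → ℝ≥0} (hφ : Continuous φ)
    (hφc : HasCompactSupport φ) (hψ : Continuous ψ) (hψc : HasCompactSupport ψ) (x : Space d) :
    posMax μ E (fun y => φ y) (fun y => ψ y) x =
      maximalAverage μ E (fun y => ((φ y : ℝ) : ℂ)) (fun y => ((ψ y : ℝ) : ℂ)) x := by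
  have hi := fun t => integrable_average (μ := μ) (f := fun y => ((φ y : ℝ) : ℂ))
    (g := fun y => ((ψ y : ℝ) : ℂ)) (by fun_prop)
    (hφc.comp_left (g := fun s : ℝ≥0 => ((s : ℝ) : ℂ)) (by simp)) (by fun_prop)
    (hψc.comp_left (g := fun s : ℝ≥0 => ((s : ℝ) : ℂ)) (by simp)) t x
  unfold posMax maximalAverage bilinearAverage
  congr 1
  ext t
  congr 1
  ext ht
  have h1 : (∫ w : Space d × Space d, ((φ (x - t • w.1) : ℝ) : ℂ) * ((ψ (x - t • w.2) : ℝ) : ℂ) ∂μ)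
      = ((∫ w : Space d × Space d, (φ (x - t • w.1) : ℝ) * (ψ (x - t • w.2) : ℝ) ∂μ : ℝ) : ℂ) := by
    rw [← integral_complex_ofReal]
    simp only [Complex.ofReal_mul]
  have h2 : Integrable (fun w : Space d × Space d =>
      (φ (x - t • w.1) : ℝ) * (ψ (x - t • w.2) : ℝ)) μ := by
    have := (hi t).re
    refine this.congr (.of_forall fun w => ?_)
    simp [← Complex.ofReal_mul]
  rw [h1, ← ofReal_norm, Complex.norm_real, Real.norm_of_nonneg (integral_nonneg fun w => by
    positivity), ofReal_integral_eq_lintegral_ofReal h2 (.of_forall fun w => by positivity)]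
  refine lintegral_congr fun w => ?_
  rw [ENNReal.ofReal_mul (by positivity), ENNReal.ofReal_coe_nnreal, ENNReal.ofReal_coe_nnreal]

/-- Uniform approximation by test functions supported in the same compact set. -/
theorem exists_seq_isTestFunction {f : Space d → ℂ} (hf : Continuous f)
    (hfc : HasCompactSupport f) :
    ∃ (F : ℕ → Space d → ℂ) (A : ℝ), (∀ n, IsTestFunction (F n)) ∧
      (∀ x, Tendsto (fun n => F n x) atTop (𝓝 (f x))) ∧ (∀ n x, ‖F n x‖ ≤ A) ∧
      ∀ p : ℝ, 0 < p → Tendsto (fun n => ∫⁻ x, ‖F n x‖ₑ ^ p) atTop (𝓝 (∫⁻ x, ‖f x‖ₑ ^ p)) := by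
  have h := fun n : ℕ => hf.exists_contDiff_approx (n := (⊤ : ℕ∞)) (ε := fun _ => 1 / ((n : ℝ) + 1))
    continuous_const (fun _ => by positivity)
  choose F hFs hFd hFsupp using h
  obtain ⟨A, hA⟩ := hfc.exists_bound_of_continuous hf
  have hlim : ∀ x, Tendsto (fun n => F n x) atTop (𝓝 (f x)) := fun x =>
    tendsto_iff_dist_tendsto_zero.2 (squeeze_zero (fun _ => dist_nonneg) (fun n => (hFd n x).le)
      tendsto_one_div_add_atTop_nhds_zero_nat)
  have hbd : ∀ n x, ‖F n x‖ ≤ A + 1 := by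
    intro n x
    have h1 : ‖F n x‖ ≤ ‖f x‖ + dist (F n x) (f x) := by
      rw [dist_eq_norm]
      calc ‖F n x‖ = ‖f x + (F n x - f x)‖ := by rw [add_sub_cancel]
        _ ≤ _ := norm_add_le _ _
    have h2 : 1 / ((n : ℝ) + 1) ≤ 1 := by
      rw [div_le_one (by positivity)]
      linarith [(Nat.cast_nonneg n : (0 : ℝ) ≤ n)]
    linarith [hA x, (hFd n x).le]
  have hcs : ∀ n, HasCompactSupport (F n) := fun n => hfc.mono (hFsupp n)
  refine ⟨F, A + 1, fun n => ⟨hFs n, hcs n⟩, hlim, hbd, fun p hp => ?_⟩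
  refine tendsto_lintegral_of_dominated_convergence
    ((tsupport f).indicator fun _ => ENNReal.ofReal (A + 1) ^ p)
    (fun n => ((hFs n).continuous.measurable.enorm.pow_const p)) (fun n => .of_forall fun x => ?_)
    ?_ (.of_forall fun x => ?_)
  · by_cases hx : x ∈ tsupport f
    · dsimp only
      rw [Set.indicator_of_mem hx, ← ofReal_norm]
      gcongr
      exact hbd n x
    · have : F n x = 0 := by
        by_contra h0
        exact hx (subset_tsupport f (hFsupp n h0))
      simp [this, hp]
  · rw [lintegral_indicator (isClosed_tsupport f).measurableSet, setLIntegral_const]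
    exact ENNReal.mul_ne_top (ENNReal.rpow_ne_top_of_nonneg hp.le ENNReal.ofReal_ne_top)
      hfc.isCompact.measure_lt_top.ne
  · exact ((ENNReal.continuous_rpow_const (y := p)).tendsto _).comp
      ((continuous_enorm.tendsto _).comp (hlim x))

/-- The `L^p × L^q → L^2` bound on test functions extends to compactly supported continuous
functions. -/
theorem lintegral_maximalAverage_sq_le_of_continuous {p q : ℝ} (hp : 0 < p) (hq : 0 < q) {K : ℝ≥0}
    (hK : ∀ f g : Space d → ℂ, IsTestFunction f → IsTestFunction g →
      ∫⁻ x, maximalAverage μ E f g x ^ 2 ≤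
        K * ((∫⁻ x, ‖f x‖ₑ ^ p) ^ (2 / p) * (∫⁻ x, ‖g x‖ₑ ^ q) ^ (2 / q)))
    {f g : Space d → ℂ} (hf : Continuous f) (hfc : HasCompactSupport f) (hg : Continuous g)
    (hgc : HasCompactSupport g) :
    ∫⁻ x, maximalAverage μ E f g x ^ 2 ≤
        K * ((∫⁻ x, ‖f x‖ₑ ^ p) ^ (2 / p) * (∫⁻ x, ‖g x‖ₑ ^ q) ^ (2 / q)) := by
  have hfin : ∀ {f : Space d → ℂ} {p : ℝ}, Continuous f → HasCompactSupport f → 0 < p →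
      (∫⁻ x, ‖f x‖ₑ ^ p) ^ (2 / p) ≠ ⊤ := by
    intro f p hf hfc hp
    refine ENNReal.rpow_ne_top_of_nonneg (by positivity) ?_
    have := (hf.memLp_of_hasCompactSupport hfc (μ := volume) (p := ENNReal.ofReal p)).2
    rw [eLpNorm_lt_top_iff_lintegral_rpow_enorm_lt_top (by simpa using hp) (by simp),
      ENNReal.toReal_ofReal hp.le] at this
    exact this.ne
  obtain ⟨F, A, hF, hFl, hFb, hFp⟩ := exists_seq_isTestFunction hf hfc
  obtain ⟨G, B, hG, hGl, hGb, hGp⟩ := exists_seq_isTestFunction hg hgc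
  have hconv : ∀ t x, Tendsto (fun n => bilinearAverage μ t (F n) (G n) x) atTop
      (𝓝 (bilinearAverage μ t f g x)) := by
    intro t x
    refine tendsto_integral_of_dominated_convergence (fun _ => A * B)
      (fun n => (integrable_average (hF n).1.continuous (hF n).2 (hG n).1.continuous (hG n).2
        t x).aestronglyMeasurable) (integrable_const _) (fun n => .of_forall fun w => ?_)
      (.of_forall fun w => (hFl _).mul (hGl _))
    rw [norm_mul]
    exact mul_le_mul (hFb n _) (hGb n _) (norm_nonneg _) ((norm_nonneg _).trans (hFb n 0))
  -- Each fixed time passes to the limit, so the supremum is at most the liminf of the suprema, and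
  -- Fatou's lemma applies.
  calc ∫⁻ x, maximalAverage μ E f g x ^ 2
      ≤ ∫⁻ x, liminf (fun n => maximalAverage μ E (F n) (G n) x ^ 2) atTop := by
        refine lintegral_mono fun x => iSup₂_sq_le fun t ht => ?_
        have h1 : Tendsto (fun n => ‖bilinearAverage μ t (F n) (G n) x‖ₑ ^ 2) atTop
            (𝓝 (‖bilinearAverage μ t f g x‖ₑ ^ 2)) :=
          ((ENNReal.continuous_pow 2).tendsto _).comp
            ((continuous_enorm.tendsto _).comp (hconv t x))
        rw [← h1.liminf_eq]
        refine liminf_le_liminf (.of_forall fun n => ?_)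
        gcongr
        exact le_iSup₂ (f := fun t (_ : t ∈ E) => ‖bilinearAverage μ t (F n) (G n) x‖ₑ) t ht
    _ ≤ liminf (fun n => ∫⁻ x, maximalAverage μ E (F n) (G n) x ^ 2) atTop :=
        lintegral_liminf_le fun n => (measurable_maximalAverage (hF n).1.continuous (hF n).2
          (hG n).1.continuous (hG n).2).pow_const 2
    _ ≤ liminf (fun n => K * ((∫⁻ x, ‖F n x‖ₑ ^ p) ^ (2 / p) *
          (∫⁻ x, ‖G n x‖ₑ ^ q) ^ (2 / q))) atTop :=
        liminf_le_liminf (.of_forall fun n => hK _ _ (hF n) (hG n))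
    _ = _ := by
        refine Tendsto.liminf_eq ?_
        refine ENNReal.Tendsto.const_mul ?_ (.inr ENNReal.coe_ne_top)
        refine ENNReal.Tendsto.mul ?_ (.inr (hfin hg hgc hq)) ?_ (.inr (hfin hf hfc hp))
        · exact ((ENNReal.continuous_rpow_const).tendsto _).comp (hFp p hp)
        · exact ((ENNReal.continuous_rpow_const).tendsto _).comp (hGp q hq)

end CompactSupport

theorem iSup_mul_iSup_of_monotone {a b : ℕ → ℝ≥0∞} (ha : Monotone a) (hb : Monotone b) :
    (⨆ n, a n) * ⨆ n, b n = ⨆ n, a n * b n := by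
  refine le_antisymm ?_ (iSup_le fun n => mul_le_mul' (le_iSup a n) (le_iSup b n))
  rw [ENNReal.iSup_mul]
  refine iSup_le fun i => ?_
  rw [ENNReal.mul_iSup]
  refine iSup_le fun j => le_trans ?_ (le_iSup _ (max i j))
  exact mul_le_mul' (ha (le_max_left i j)) (hb (le_max_right i j))

/-- A majorant in the form of a lower semicontinuous function, for powers. -/
theorem exists_lowerSemicontinuous_le_lintegral_rpow {f : Space d → ℝ≥0} (hf : AEMeasurable f)
    {p : ℝ} (hp : 0 < p) {ε : ℝ≥0∞} (hε : ε ≠ 0) :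
    ∃ H : Space d → ℝ≥0∞, (∀ x, (f x : ℝ≥0∞) ≤ H x) ∧ LowerSemicontinuous H ∧
      ∫⁻ x, H x ^ p ≤ (∫⁻ x, (f x : ℝ≥0∞) ^ p) + ε := by
  -- The semicontinuous majorant is taken for `f^p`; its `p`-th root remains lower semicontinuous.
  obtain ⟨h, hfh, hh, hint⟩ := exists_lt_lowerSemicontinuous_lintegral_ge_of_aemeasurable volume
    (fun x => f x ^ p) (hf.pow_const p) hε
  refine ⟨fun x => h x ^ (1 / p), fun x => ?_,
    (ENNReal.continuous_rpow_const (y := 1 / p)).comp_lowerSemicontinuous hh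
      (ENNReal.monotone_rpow_of_nonneg (by positivity)), ?_⟩
  · have h1 := (hfh x).le
    rw [ENNReal.coe_rpow_of_nonneg _ hp.le] at h1
    calc (f x : ℝ≥0∞) = ((f x : ℝ≥0∞) ^ p) ^ (1 / p) := by
          rw [← ENNReal.rpow_mul, mul_one_div_cancel hp.ne', ENNReal.rpow_one]
      _ ≤ _ := ENNReal.rpow_le_rpow h1 (by positivity)
  · simp only [← ENNReal.rpow_mul, one_div_mul_cancel hp.ne', ENNReal.rpow_one]
    simpa only [ENNReal.coe_rpow_of_nonneg _ hp.le] using hint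

section

variable {μ : Measure (Space d × Space d)} [IsFiniteMeasure μ] {E : Set ℝ} {p q : ℝ} {K : ℝ≥0}

/-- Increasing continuous approximants exhaust `H` and `L`. Monotone convergence in `μ` together
with an exchange of the suprema over `t` and `n` makes `posMax` a countable supremum; monotone
convergence in `x` carries the bound over. -/
theorem lintegral_posMax_sq_le_of_lowerSemicontinuous (hp : 0 < p) (hq : 0 < q)
    (hK : ∀ f g : Space d → ℂ, IsTestFunction f → IsTestFunction g →
      ∫⁻ x, maximalAverage μ E f g x ^ 2 ≤
        K * ((∫⁻ x, ‖f x‖ₑ ^ p) ^ (2 / p) * (∫⁻ x, ‖g x‖ₑ ^ q) ^ (2 / q)))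
    {H L : Space d → ℝ≥0∞} (hH : LowerSemicontinuous H) (hL : LowerSemicontinuous L) :
    Measurable (posMax μ E H L) ∧ ∫⁻ x, posMax μ E H L x ^ 2 ≤
        K * ((∫⁻ x, H x ^ p) ^ (2 / p) * (∫⁻ x, L x ^ q) ^ (2 / q)) := by
  obtain ⟨φ, hφm, hφ, hφc, hφH⟩ := exists_monotone_seq_iSup_eq_of_lowerSemicontinuous hH
  obtain ⟨ψ, hψm, hψ, hψc, hψL⟩ := exists_monotone_seq_iSup_eq_of_lowerSemicontinuous hL
  have hφle : ∀ n x, (φ n x : ℝ≥0∞) ≤ H x := fun n x =>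
    hφH x ▸ le_iSup (fun n => (φ n x : ℝ≥0∞)) n
  have hψle : ∀ n x, (ψ n x : ℝ≥0∞) ≤ L x := fun n x =>
    hψL x ▸ le_iSup (fun n => (ψ n x : ℝ≥0∞)) n
  set P : ℕ → Space d → ℝ≥0∞ := fun n => posMax μ E (fun y => φ n y) (fun y => ψ n y) with hP
  have hPm : ∀ n, Measurable (P n) := by
    intro n
    have h1 : P n = maximalAverage μ E (fun y => ((φ n y : ℝ) : ℂ)) (fun y => ((ψ n y : ℝ) : ℂ)) :=
      funext fun x => posMax_coe_eq_maximalAverage (hφ n) (hφc n) (hψ n) (hψc n) x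
    have h2 := hφ n
    have h3 := hψ n
    rw [h1]
    exact measurable_maximalAverage (by fun_prop)
      ((hφc n).comp_left (g := fun s : ℝ≥0 => ((s : ℝ) : ℂ)) (by simp)) (by fun_prop)
      ((hψc n).comp_left (g := fun s : ℝ≥0 => ((s : ℝ) : ℂ)) (by simp))
  have hPint : ∀ n, ∫⁻ x, P n x ^ 2 ≤
      K * ((∫⁻ x, H x ^ p) ^ (2 / p) * (∫⁻ x, L x ^ q) ^ (2 / q)) := by
    intro n
    have h2 := hφ n
    have h3 := hψ n
    have h := lintegral_maximalAverage_sq_le_of_continuous (μ := μ) (E := E) hp hq hK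
      (f := fun y => ((φ n y : ℝ) : ℂ)) (g := fun y => ((ψ n y : ℝ) : ℂ)) (by fun_prop)
      ((hφc n).comp_left (g := fun s : ℝ≥0 => ((s : ℝ) : ℂ)) (by simp)) (by fun_prop)
      ((hψc n).comp_left (g := fun s : ℝ≥0 => ((s : ℝ) : ℂ)) (by simp))
    simp only [← posMax_coe_eq_maximalAverage (hφ n) (hφc n) (hψ n) (hψc n)] at h
    have he : ∀ s : ℝ≥0, ‖((s : ℝ) : ℂ)‖ₑ = s := fun s => by
      rw [← ofReal_norm, Complex.norm_real, Real.norm_of_nonneg s.coe_nonneg,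
        ENNReal.ofReal_coe_nnreal]
    simp only [he] at h
    refine h.trans ?_
    gcongr with x x
    · exact hφle n x
    · exact hψle n x
  have hPmono : Monotone P := by
    intro n m hnm x
    exact posMax_mono μ E (fun y => ENNReal.coe_le_coe.2 (hφm hnm y))
      (fun y => ENNReal.coe_le_coe.2 (hψm hnm y)) x
  have hsup : ∀ x, posMax μ E H L x = ⨆ n, P n x := by
    intro x
    refine le_antisymm (iSup₂_le fun t ht => ?_) (iSup_le fun n => posMax_mono μ E (hφle n)
      (hψle n) x)
    have h1 : ∀ w : Space d × Space d, H (x - t • w.1) * L (x - t • w.2) =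
        ⨆ n, (φ n (x - t • w.1) : ℝ≥0∞) * ψ n (x - t • w.2) := by
      intro w
      rw [← hφH, ← hψL]
      exact iSup_mul_iSup_of_monotone (fun n m hnm => ENNReal.coe_le_coe.2 (hφm hnm _))
        (fun n m hnm => ENNReal.coe_le_coe.2 (hψm hnm _))
    simp only [h1]
    rw [lintegral_iSup]
    · refine iSup_mono fun n => ?_
      exact le_iSup₂ (f := fun t (_ : t ∈ E) =>
        ∫⁻ w : Space d × Space d, (φ n (x - t • w.1) : ℝ≥0∞) * ψ n (x - t • w.2) ∂μ) t ht
    · intro n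
      have h2 := hφ n
      have h3 := hψ n
      exact (Continuous.measurable (by fun_prop)).coe_nnreal_ennreal.mul
        (Continuous.measurable (by fun_prop)).coe_nnreal_ennreal
    · intro n m hnm w
      exact mul_le_mul' (ENNReal.coe_le_coe.2 (hφm hnm _)) (ENNReal.coe_le_coe.2 (hψm hnm _))
  refine ⟨?_, ?_⟩
  · rw [funext hsup]
    exact Measurable.iSup hPm
  · calc ∫⁻ x, posMax μ E H L x ^ 2 ≤ ∫⁻ x, ⨆ n, P n x ^ 2 := by
          refine lintegral_mono fun x => ?_
          dsimp only
          rw [hsup, sq, iSup_mul_iSup_of_monotone (fun _ _ h => hPmono h x)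
            (fun _ _ h => hPmono h x)]
          simp only [sq, le_refl]
      _ = ⨆ n, ∫⁻ x, P n x ^ 2 := lintegral_iSup (fun n => (hPm n).pow_const 2)
          fun n m hnm x => pow_le_pow_left' (hPmono hnm x) 2
      _ ≤ _ := iSup_le hPint

/-- A measurable majorant of the maximal average for arbitrary `L^p` and `L^q` functions. -/
theorem exists_measurable_posMax_le (hp : 0 < p) (hq : 0 < q)
    (hK : ∀ f g : Space d → ℂ, IsTestFunction f → IsTestFunction g →
      ∫⁻ x, maximalAverage μ E f g x ^ 2 ≤
        K * ((∫⁻ x, ‖f x‖ₑ ^ p) ^ (2 / p) * (∫⁻ x, ‖g x‖ₑ ^ q) ^ (2 / q)))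
    {f g : Space d → ℝ≥0} (hf : AEMeasurable f) (hg : AEMeasurable g)
    (hfp : ∫⁻ x, (f x : ℝ≥0∞) ^ p ≠ ⊤) (hgq : ∫⁻ x, (g x : ℝ≥0∞) ^ q ≠ ⊤) :
    ∃ W : Space d → ℝ≥0∞, Measurable W ∧
      (∀ x, posMax μ E (fun y => f y) (fun y => g y) x ≤ W x) ∧
      ∫⁻ x, W x ^ 2 ≤
        K * ((∫⁻ x, (f x : ℝ≥0∞) ^ p) ^ (2 / p) * (∫⁻ x, (g x : ℝ≥0∞) ^ q) ^ (2 / q)) := by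
  set I := ∫⁻ x, (f x : ℝ≥0∞) ^ p with hI
  set J := ∫⁻ x, (g x : ℝ≥0∞) ^ q with hJ
  have hε : ∀ n : ℕ, ((n : ℝ≥0∞))⁻¹ ≠ 0 := fun n => by simp
  choose H hfH hH hHI using fun n => exists_lowerSemicontinuous_le_lintegral_rpow hf hp (hε n)
  choose L hgL hL hLJ using fun n => exists_lowerSemicontinuous_le_lintegral_rpow hg hq (hε n)
  have hB := fun n => lintegral_posMax_sq_le_of_lowerSemicontinuous (μ := μ) (E := E) hp hq hK
    (hH n) (hL n)
  -- The infimum over better and better majorants is still a measurable majorant and removes the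
  -- error `1/n`. At `n = 0` the error is `⊤`, which is harmless.
  refine ⟨fun x => ⨅ n, posMax μ E (H n) (L n) x, Measurable.iInf fun n => (hB n).1,
    fun x => le_iInf fun n => posMax_mono μ E (hfH n) (hgL n) x, ?_⟩
  have h1 : ∀ n : ℕ, ∫⁻ x, (⨅ n, posMax μ E (H n) (L n) x) ^ 2 ≤
      K * ((I + (n : ℝ≥0∞)⁻¹) ^ (2 / p) * (J + (n : ℝ≥0∞)⁻¹) ^ (2 / q)) := by
    intro n
    calc _ ≤ ∫⁻ x, posMax μ E (H n) (L n) x ^ 2 := by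
          gcongr with x
          exact iInf_le _ n
      _ ≤ _ := (hB n).2
      _ ≤ _ := by
          gcongr
          · exact hHI n
          · exact hLJ n
  refine ge_of_tendsto' (x := atTop) ?_ h1
  have hadd : ∀ A : ℝ≥0∞, Tendsto (fun n : ℕ => A + (n : ℝ≥0∞)⁻¹) atTop (𝓝 A) := by
    intro A
    simpa using tendsto_const_nhds.add ENNReal.tendsto_inv_nat_nhds_zero
  refine ENNReal.Tendsto.const_mul ?_ (.inr ENNReal.coe_ne_top)
  refine ENNReal.Tendsto.mul ?_ (.inr (ENNReal.rpow_ne_top_of_nonneg (by positivity) hgq)) ?_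
    (.inr (ENNReal.rpow_ne_top_of_nonneg (by positivity) hfp))
  · exact (ENNReal.continuous_rpow_const.tendsto _).comp (hadd I)
  · exact (ENNReal.continuous_rpow_const.tendsto _).comp (hadd J)

end

/-! ### Localization to unit cubes: exponents `r ≤ 2` -/

/-- The index of the unit cube that contains a point. -/
def cubeIndex (x : Space d) (i : Fin d) : ℤ := ⌊x i⌋

theorem measurable_cubeIndex : Measurable (cubeIndex : Space d → Fin d → ℤ) :=
  measurable_pi_lambda _ fun i => Int.measurable_floor.comp
    (by fun_prop : Continuous fun x : Space d => x i).measurable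

/-- The unit cubes within distance `m` of the unit cube with index `l`. -/
def cubeNhd (m : ℕ) (l : Fin d → ℤ) : Set (Space d) :=
  {x | l ∈ Finset.Icc (cubeIndex x - fun _ => (m : ℤ)) (cubeIndex x + fun _ => (m : ℤ))}

theorem measurableSet_cubeNhd (m : ℕ) (l : Fin d → ℤ) : MeasurableSet (cubeNhd (d := d) m l) :=
  measurable_cubeIndex (MeasurableSet.of_discrete (s := {n : Fin d → ℤ |
    l ∈ Finset.Icc (n - fun _ => (m : ℤ)) (n + fun _ => (m : ℤ))}))

/-- Each point lies in exactly `(2m + 1)^d` of the neighbourhoods, one for each index within `m` of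
its own in every coordinate. -/
theorem tsum_setLIntegral_cubeNhd (m : ℕ) {h : Space d → ℝ≥0∞} (hh : AEMeasurable h) :
    ∑' l, ∫⁻ x in cubeNhd m l, h x = (2 * m + 1) ^ d * ∫⁻ x, h x := by
  have h1 : ∀ x : Space d, ∑' l, (cubeNhd m l).indicator h x = (2 * m + 1) ^ d * h x := by
    intro x
    set s := Finset.Icc (cubeIndex x - fun _ => (m : ℤ)) (cubeIndex x + fun _ => (m : ℤ)) with hs
    rw [tsum_eq_sum (s := s) fun l hl => Set.indicator_of_notMem (by exact hl) h,
      Finset.sum_congr rfl fun l hl => Set.indicator_of_mem (show x ∈ cubeNhd m l from hl) h,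
      Finset.sum_const, nsmul_eq_mul, Pi.card_Icc]
    congr 1
    have : ∀ i : Fin d, (Finset.Icc ((cubeIndex x - fun _ => (m : ℤ) : Fin d → ℤ) i)
        ((cubeIndex x + fun _ => (m : ℤ) : Fin d → ℤ) i)).card = 2 * m + 1 := by
      intro i
      rw [Int.card_Icc]
      simp only [Pi.add_apply, Pi.sub_apply]
      omega
    rw [Finset.prod_congr rfl fun i _ => this i]
    simp
  simp only [← lintegral_indicator (measurableSet_cubeNhd m _)]
  rw [← lintegral_tsum fun l => hh.indicator (measurableSet_cubeNhd m l)]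
  simp only [h1]
  exact lintegral_const_mul' _ _ (by finiteness)

theorem volume_cube_le (hd : 1 ≤ d) (l : Fin d → ℤ) :
    volume (cubeIndex ⁻¹' {l} : Set (Space d)) ≤ volume (Metric.ball (0 : Space d) (d + 1)) := by
  rw [← Measure.addHaar_ball_center volume (WithLp.toLp 2 fun i => (l i : ℝ)) (d + 1 : ℝ)]
  refine measure_mono fun x hx => ?_
  have hx' : cubeIndex x = l := hx
  rw [Metric.mem_ball, dist_eq_norm, EuclideanSpace.norm_eq]
  have h1 : ∑ i, ‖(x - WithLp.toLp 2 fun i => (l i : ℝ)) i‖ ^ 2 ≤ ∑ _i : Fin d, (1 : ℝ) := by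
    refine Finset.sum_le_sum fun i _ => ?_
    have h2 : ⌊x i⌋ = l i := congrFun hx' i
    rw [Int.floor_eq_iff] at h2
    have h3 : |x i - l i| ≤ 1 := abs_le.2 ⟨by linarith [h2.1], by linarith [h2.2]⟩
    have h4 : (x - WithLp.toLp 2 fun i => (l i : ℝ)) i = x i - l i := rfl
    rw [h4, Real.norm_eq_abs]
    exact pow_le_one₀ (abs_nonneg _) h3
  have hd1 : (1 : ℝ) ≤ d := by exact_mod_cast hd
  calc √(∑ i, ‖(x - WithLp.toLp 2 fun i => (l i : ℝ)) i‖ ^ 2) ≤ √(d : ℝ) := by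
        gcongr
        simpa using h1
    _ < d + 1 := by
        rw [Real.sqrt_lt' (by positivity)]
        nlinarith

/-- Hölder's inequality for sums, for exponents with `r / p + r / q ≥ 1`. -/
theorem tsum_rpow_mul_rpow_le {ι : Type*} {a b : ι → ℝ≥0∞} {α γ : ℝ} (hα : 0 < α) (hγ : 0 < γ)
    (hαγ : 1 ≤ α + γ) (ha : ∑' i, a i ≠ ⊤) (hb : ∑' i, b i ≠ ⊤) :
    ∑' i, a i ^ α * b i ^ γ ≤ 2 * ((∑' i, a i) ^ α * (∑' i, b i) ^ γ) := by
  set A := ∑' i, a i with hA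
  set B := ∑' i, b i with hB
  have haA : ∀ i, a i ≤ A := fun i => ENNReal.le_tsum i
  have hbB : ∀ i, b i ≤ B := fun i => ENNReal.le_tsum i
  rcases eq_or_ne A 0 with h0 | h0
  · have : ∀ i, a i = 0 := fun i => le_antisymm (h0 ▸ haA i) bot_le
    simp [this, hα]
  rcases eq_or_ne B 0 with h1 | h1
  · have : ∀ i, b i = 0 := fun i => le_antisymm (h1 ▸ hbB i) bot_le
    simp [this, hγ]
  -- After normalization by the totals all terms are at most `1`, so `x^α y^γ ≤ max(x, y)^{α + γ} ≤
  -- max(x, y) ≤ x + y`. The last step accounts for the factor `2`.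
  have hpt : ∀ i, a i ^ α * b i ^ γ ≤ (A⁻¹ * a i + B⁻¹ * b i) * (A ^ α * B ^ γ) := by
    intro i
    set x := A⁻¹ * a i with hx
    set y := B⁻¹ * b i with hy
    have hxa : a i = x * A := by
      rw [hx, mul_comm, ← mul_assoc, ENNReal.mul_inv_cancel h0 ha, one_mul]
    have hyb : b i = y * B := by
      rw [hy, mul_comm, ← mul_assoc, ENNReal.mul_inv_cancel h1 hb, one_mul]
    have hx1 : x ≤ 1 := by
      rw [hx, ← ENNReal.inv_mul_cancel h0 ha]
      gcongr
      exact haA i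
    have hy1 : y ≤ 1 := by
      rw [hy, ← ENNReal.inv_mul_cancel h1 hb]
      gcongr
      exact hbB i
    have hM : x ^ α * y ^ γ ≤ x + y := by
      calc x ^ α * y ^ γ ≤ (max x y) ^ α * (max x y) ^ γ := by
            gcongr
            · exact le_max_left _ _
            · exact le_max_right _ _
        _ = (max x y) ^ (α + γ) := (ENNReal.rpow_add_of_nonneg _ _ hα.le hγ.le).symm
        _ ≤ (max x y) ^ (1 : ℝ) := ENNReal.rpow_le_rpow_of_exponent_ge (max_le hx1 hy1) hαγ
        _ ≤ x + y := by
            rw [ENNReal.rpow_one]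
            exact max_le le_self_add le_add_self
    rw [hxa, hyb, ENNReal.mul_rpow_of_nonneg _ _ hα.le, ENNReal.mul_rpow_of_nonneg _ _ hγ.le,
      mul_mul_mul_comm]
    gcongr
  calc ∑' i, a i ^ α * b i ^ γ ≤ ∑' i, (A⁻¹ * a i + B⁻¹ * b i) * (A ^ α * B ^ γ) :=
        ENNReal.tsum_le_tsum hpt
    _ = (A⁻¹ * A + B⁻¹ * B) * (A ^ α * B ^ γ) := by
        rw [ENNReal.tsum_mul_right, ENNReal.tsum_add, ENNReal.tsum_mul_left, ENNReal.tsum_mul_left]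
    _ = _ := by
        rw [ENNReal.inv_mul_cancel h0 ha, ENNReal.inv_mul_cancel h1 hb, one_add_one_eq_two]

theorem lintegral_rpow_le_of_le_two {α : Type*} [MeasurableSpace α] (ν : Measure α)
    {W : α → ℝ≥0∞} (hW : AEMeasurable W ν) {r : ℝ} (hr : 0 < r) (hr2 : r ≤ 2) :
    ∫⁻ x, W x ^ r ∂ν ≤ (∫⁻ x, W x ^ 2 ∂ν) ^ (r / 2) * ν Set.univ ^ (1 - r / 2) := by
  have h := eLpNorm'_le_eLpNorm'_mul_rpow_measure_univ hr hr2 hW.aestronglyMeasurable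
  have h2 := ENNReal.rpow_le_rpow h hr.le
  simp only [eLpNorm', enorm_eq_self] at h2
  rw [← ENNReal.rpow_mul, one_div_mul_cancel hr.ne', ENNReal.rpow_one,
    ENNReal.mul_rpow_of_nonneg _ _ hr.le, ← ENNReal.rpow_mul, ← ENNReal.rpow_mul] at h2
  have e1 : 1 / 2 * r = r / 2 := by ring
  have e2 : (1 / r - 1 / 2) * r = 1 - r / 2 := by field_simp
  rw [e1, e2] at h2
  simpa using h2

theorem mem_cubeNhd_sub {ρ : ℝ} {m : ℕ} (hm : 2 * ρ ≤ m) (x : Space d) {y : Space d}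
    (hy : ‖y‖ ≤ ρ) {t : ℝ} (h1 : 1 ≤ t) (h2 : t ≤ 2) :
    x - t • y ∈ cubeNhd m (cubeIndex x) := by
  have hb : ∀ i, |t * y i| ≤ m := by
    intro i
    rw [abs_mul, abs_of_nonneg (by linarith)]
    have h3 : |y i| ≤ ‖y‖ := by
      rw [← Real.norm_eq_abs]
      exact PiLp.norm_apply_le y i
    calc t * |y i| ≤ 2 * ρ := mul_le_mul h2 (h3.trans hy) (abs_nonneg _) (by norm_num)
      _ ≤ m := hm
  refine Finset.mem_Icc.2 ⟨fun i => ?_, fun i => ?_⟩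
  · change ⌊x i - t * y i⌋ - (m : ℤ) ≤ ⌊x i⌋
    rw [← Int.floor_sub_natCast]
    exact Int.floor_le_floor (by linarith [(abs_le.1 (hb i)).1])
  · change ⌊x i⌋ ≤ ⌊x i - t * y i⌋ + (m : ℤ)
    rw [← Int.floor_add_natCast]
    exact Int.floor_le_floor (by linarith [(abs_le.1 (hb i)).2])

/-- Localization to unit cubes: the bound into `L^2` implies bounds into `L^r` for smaller `r`, as
long as `1 / r ≤ 1 / p + 1 / q`. -/
theorem exists_measurable_posMax_rpow_le (hd : 1 ≤ d) {μ : Measure (Space d × Space d)}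
    [IsFiniteMeasure μ] (hμ : CompactlySupported μ) {E : Set ℝ} (hE : E ⊆ Set.Icc 1 2)
    {p q r : ℝ} (hp : 0 < p) (hq : 0 < q) (hr : 0 < r) (hr2 : r ≤ 2) (hpqr : 1 ≤ r / p + r / q)
    {K : ℝ≥0} (hK : ∀ f g : Space d → ℂ, IsTestFunction f → IsTestFunction g →
      ∫⁻ x, maximalAverage μ E f g x ^ 2 ≤
        K * ((∫⁻ x, ‖f x‖ₑ ^ p) ^ (2 / p) * (∫⁻ x, ‖g x‖ₑ ^ q) ^ (2 / q))) :
    ∃ C : ℝ≥0, ∀ f g : Space d → ℝ≥0, AEMeasurable f → AEMeasurable g →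
      ∫⁻ x, (f x : ℝ≥0∞) ^ p ≠ ⊤ → ∫⁻ x, (g x : ℝ≥0∞) ^ q ≠ ⊤ →
      ∃ W : Space d → ℝ≥0∞, Measurable W ∧
        (∀ x, posMax μ E (fun y => f y) (fun y => g y) x ≤ W x) ∧
        ∫⁻ x, W x ^ r ≤
          C * ((∫⁻ x, (f x : ℝ≥0∞) ^ p) ^ (r / p) * (∫⁻ x, (g x : ℝ≥0∞) ^ q) ^ (r / q)) := by
  obtain ⟨ρ, hρ, hw⟩ := hμ.exists_norm_le
  obtain ⟨m, hm⟩ := exists_nat_ge (2 * ρ)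
  set V := volume (Metric.ball (0 : Space d) (d + 1)) with hV
  have hVtop : V ≠ ⊤ := measure_ball_lt_top.ne
  set N : ℝ≥0∞ := (2 * m + 1) ^ d with hN
  have hNtop : N ≠ ⊤ := by finiteness
  set C : ℝ≥0∞ := (K : ℝ≥0∞) ^ (r / 2) * V ^ (1 - r / 2) * 2 * (N ^ (r / p) * N ^ (r / q)) with hC
  have hrp : 0 < r / p := by positivity
  have hrq : 0 < r / q := by positivity
  have hr2' : 0 ≤ 1 - r / 2 := by linarith
  have hCtop : C ≠ ⊤ := by
    refine ENNReal.mul_ne_top (ENNReal.mul_ne_top (ENNReal.mul_ne_top ?_ ?_) (by norm_num))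
      (ENNReal.mul_ne_top ?_ ?_)
    · exact ENNReal.rpow_ne_top_of_nonneg (by positivity) ENNReal.coe_ne_top
    · exact ENNReal.rpow_ne_top_of_nonneg hr2' hVtop
    · exact ENNReal.rpow_ne_top_of_nonneg hrp.le hNtop
    · exact ENNReal.rpow_ne_top_of_nonneg hrq.le hNtop
  refine ⟨C.toNNReal, fun f g hf hg hfp hgq => ?_⟩
  rw [ENNReal.coe_toNNReal hCtop]
  have hloc : ∀ (h : Space d → ℝ≥0) (s : ℝ), 0 < s → ∀ l,
      ∫⁻ x, (((cubeNhd m l).indicator h x : ℝ≥0) : ℝ≥0∞) ^ s =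
        ∫⁻ x in cubeNhd m l, (h x : ℝ≥0∞) ^ s := by
    intro h s hs l
    rw [← lintegral_indicator (measurableSet_cubeNhd m l)]
    refine lintegral_congr fun x => ?_
    by_cases hx : x ∈ cubeNhd m l <;> simp [hx, hs]
  have hloc_top : ∀ (h : Space d → ℝ≥0) (s : ℝ), ∫⁻ x, (h x : ℝ≥0∞) ^ s ≠ ⊤ → ∀ l,
      ∫⁻ x in cubeNhd m l, (h x : ℝ≥0∞) ^ s ≠ ⊤ := fun h s hs l =>
    ne_top_of_le_ne_top hs (setLIntegral_le_lintegral _ _)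
  have hW := fun l => exists_measurable_posMax_le (μ := μ) (E := E) hp hq hK
    (hf.indicator (measurableSet_cubeNhd m l)) (hg.indicator (measurableSet_cubeNhd m l))
    (by rw [hloc f p hp l]; exact hloc_top f p hfp l)
    (by rw [hloc g q hq l]; exact hloc_top g q hgq l)
  simp only [hloc f p hp, hloc g q hq] at hW
  choose W hWm hWle hWint using hW
  -- The majorant is glued: on each cube, use the one obtained from `f` and `g` cut off to its
  -- neighbourhood. Averages at points of the cube do not notice the cut-off.
  refine ⟨fun x => W (cubeIndex x) x, ?_, fun x => ?_, ?_⟩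
  · have h1 : Measurable fun z : (Fin d → ℤ) × Space d => W z.1 z.2 :=
      measurable_from_prod_countable_right fun l => hWm l
    exact h1.comp (measurable_cubeIndex.prodMk measurable_id)
  · refine le_trans (iSup₂_le fun t ht => ?_) (hWle (cubeIndex x) x)
    refine le_trans (lintegral_mono_ae ?_) (le_iSup₂ (f := fun t (_ : t ∈ E) =>
      ∫⁻ w : Space d × Space d, (((cubeNhd m (cubeIndex x)).indicator f (x - t • w.1) : ℝ≥0) : ℝ≥0∞) *
        (((cubeNhd m (cubeIndex x)).indicator g (x - t • w.2) : ℝ≥0) : ℝ≥0∞) ∂μ) t ht)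
    filter_upwards [hw] with w hw
    rw [Set.indicator_of_mem (mem_cubeNhd_sub hm x ((norm_fst_le w).trans hw) (hE ht).1 (hE ht).2),
      Set.indicator_of_mem (mem_cubeNhd_sub hm x ((norm_snd_le w).trans hw) (hE ht).1 (hE ht).2)]
  · have hQm : ∀ l : Fin d → ℤ, MeasurableSet (cubeIndex ⁻¹' {l} : Set (Space d)) := fun l =>
      measurable_cubeIndex (measurableSet_singleton l)
    have hQU : ⋃ l : Fin d → ℤ, (cubeIndex ⁻¹' {l} : Set (Space d)) = Set.univ :=
      Set.eq_univ_of_forall fun x => Set.mem_iUnion.2 ⟨cubeIndex x, rfl⟩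
    have hQd : Pairwise (Function.onFun Disjoint fun l : Fin d → ℤ =>
        (cubeIndex ⁻¹' {l} : Set (Space d))) := by
      intro l l' hll
      exact Disjoint.preimage _ (Set.disjoint_singleton.2 hll)
    have hcube : ∀ l, ∫⁻ x in cubeIndex ⁻¹' {l}, W (cubeIndex x) x ^ r ≤
        (K : ℝ≥0∞) ^ (r / 2) * V ^ (1 - r / 2) * ((∫⁻ x in cubeNhd m l, (f x : ℝ≥0∞) ^ p) ^ (r / p) *
          (∫⁻ x in cubeNhd m l, (g x : ℝ≥0∞) ^ q) ^ (r / q)) := by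
      intro l
      calc ∫⁻ x in cubeIndex ⁻¹' {l}, W (cubeIndex x) x ^ r
          = ∫⁻ x in cubeIndex ⁻¹' {l}, W l x ^ r := by
            refine setLIntegral_congr_fun (hQm l) fun x hx => ?_
            have hx' : cubeIndex x = l := hx
            simp only [hx']
        _ ≤ (∫⁻ x in cubeIndex ⁻¹' {l}, W l x ^ 2) ^ (r / 2) *
              (volume.restrict (cubeIndex ⁻¹' {l}) Set.univ) ^ (1 - r / 2) :=
            lintegral_rpow_le_of_le_two _ (hWm l).aemeasurable hr hr2
        _ ≤ (K * ((∫⁻ x in cubeNhd m l, (f x : ℝ≥0∞) ^ p) ^ (2 / p) *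
              (∫⁻ x in cubeNhd m l, (g x : ℝ≥0∞) ^ q) ^ (2 / q))) ^ (r / 2) *
                V ^ (1 - r / 2) := by
            gcongr
            · exact (setLIntegral_le_lintegral _ _).trans (hWint l)
            · rw [Measure.restrict_apply_univ]
              exact volume_cube_le hd l
        _ = _ := by
            have e1 : 2 / p * (r / 2) = r / p := by ring
            have e2 : 2 / q * (r / 2) = r / q := by ring
            rw [ENNReal.mul_rpow_of_nonneg _ _ (by positivity),
              ENNReal.mul_rpow_of_nonneg _ _ (by positivity), ← ENNReal.rpow_mul,
              ← ENNReal.rpow_mul, e1, e2]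
            ring
    have hsum : ∀ (h : Space d → ℝ≥0) (s : ℝ), AEMeasurable h →
        ∑' l, ∫⁻ x in cubeNhd m l, (h x : ℝ≥0∞) ^ s = N * ∫⁻ x, (h x : ℝ≥0∞) ^ s := fun h s hh =>
      tsum_setLIntegral_cubeNhd m (hh.coe_nnreal_ennreal.pow_const s)
    have htop : ∀ (h : Space d → ℝ≥0) (s : ℝ), AEMeasurable h → ∫⁻ x, (h x : ℝ≥0∞) ^ s ≠ ⊤ →
        ∑' l, ∫⁻ x in cubeNhd m l, (h x : ℝ≥0∞) ^ s ≠ ⊤ := fun h s hh hs => by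
      rw [hsum h s hh]
      exact ENNReal.mul_ne_top hNtop hs
    calc ∫⁻ x, W (cubeIndex x) x ^ r
        = ∑' l, ∫⁻ x in cubeIndex ⁻¹' {l}, W (cubeIndex x) x ^ r := by
          rw [← lintegral_iUnion hQm hQd, hQU, Measure.restrict_univ]
      _ ≤ ∑' l, (K : ℝ≥0∞) ^ (r / 2) * V ^ (1 - r / 2) *
            ((∫⁻ x in cubeNhd m l, (f x : ℝ≥0∞) ^ p) ^ (r / p) *
              (∫⁻ x in cubeNhd m l, (g x : ℝ≥0∞) ^ q) ^ (r / q)) := ENNReal.tsum_le_tsum hcube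
      _ ≤ (K : ℝ≥0∞) ^ (r / 2) * V ^ (1 - r / 2) *
            (2 * ((N * ∫⁻ x, (f x : ℝ≥0∞) ^ p) ^ (r / p) *
              (N * ∫⁻ x, (g x : ℝ≥0∞) ^ q) ^ (r / q))) := by
          rw [ENNReal.tsum_mul_left, ← hsum f p hf, ← hsum g q hg]
          gcongr
          exact tsum_rpow_mul_rpow_le hrp hrq hpqr (htop f p hf hfp) (htop g q hg hgq)
      _ = _ := by
          rw [ENNReal.mul_rpow_of_nonneg _ _ hrp.le, ENNReal.mul_rpow_of_nonneg _ _ hrq.le, hC]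
          ring

/-! ### General `L^p` functions: convergence, measurability, null sets -/

theorem eLpNorm_ofReal_eq {α ε : Type*} [MeasurableSpace α] [ENorm ε] (ν : Measure α) {p : ℝ}
    (hp : 0 < p) (f : α → ε) :
    eLpNorm f (ENNReal.ofReal p) ν = (∫⁻ x, ‖f x‖ₑ ^ p ∂ν) ^ (1 / p) := by
  rw [eLpNorm_eq_lintegral_rpow_enorm_toReal (by simpa using hp) (by simp),
    ENNReal.toReal_ofReal hp.le]

/-- A Borel-Cantelli argument: `∑ W_n^r` has finite integral, so it is finite almost everywhere and
its terms tend to `0`. -/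
theorem ae_tendsto_zero_of_lintegral_rpow_le {α : Type*} [MeasurableSpace α] {ν : Measure α}
    {W : ℕ → α → ℝ≥0∞} (hW : ∀ n, Measurable (W n)) {r : ℝ} (hr : 0 < r) {M ρ : ℝ≥0∞}
    (hM : M ≠ ⊤) (hρ : ρ < 1) (h : ∀ n, ∫⁻ x, W n x ^ r ∂ν ≤ M * ρ ^ n) :
    ∀ᵐ x ∂ν, Tendsto (fun n => W n x) atTop (𝓝 0) := by
  have hsum : ∫⁻ x, ∑' n, W n x ^ r ∂ν ≠ ⊤ := by
    rw [lintegral_tsum fun n => ((hW n).pow_const r).aemeasurable]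
    refine ne_top_of_le_ne_top ?_ (ENNReal.tsum_le_tsum h)
    rw [ENNReal.tsum_mul_left, ENNReal.tsum_geometric]
    exact ENNReal.mul_ne_top hM (ENNReal.inv_ne_top.2 (tsub_pos_of_lt hρ).ne')
  filter_upwards [ae_lt_top (Measurable.tsum fun n => (hW n).pow_const r) hsum] with x hx
  have h1 := ENNReal.tendsto_atTop_zero_of_tsum_ne_top hx.ne
  have h2 := ((ENNReal.continuous_rpow_const (y := 1 / r)).tendsto 0).comp h1
  rw [ENNReal.zero_rpow_of_pos (by positivity)] at h2
  refine h2.congr fun n => ?_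
  simp only [Function.comp, ← ENNReal.rpow_mul, mul_one_div_cancel hr.ne', ENNReal.rpow_one]

/-- The strong form of the bound on `posMax`: there is a measurable majorant in `L^r`. -/
def HasPosMaxBound (μ : Measure (Space d × Space d)) (E : Set ℝ) (p q r : ℝ) (C : ℝ≥0) : Prop :=
  ∀ f g : Space d → ℝ≥0, AEMeasurable f → AEMeasurable g →
    ∫⁻ x, (f x : ℝ≥0∞) ^ p ≠ ⊤ → ∫⁻ x, (g x : ℝ≥0∞) ^ q ≠ ⊤ →
    ∃ W : Space d → ℝ≥0∞, Measurable W ∧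
      (∀ x, posMax μ E (fun y => f y) (fun y => g y) x ≤ W x) ∧
      ∫⁻ x, W x ^ r ≤
        C * ((∫⁻ x, (f x : ℝ≥0∞) ^ p) ^ (r / p) * (∫⁻ x, (g x : ℝ≥0∞) ^ q) ^ (r / q))

section

variable {μ : Measure (Space d × Space d)} {E : Set ℝ} {p q r : ℝ} {C : ℝ≥0}

theorem lintegral_rpow_ne_top_of_memLp {f : Space d → ℂ} (hp : 0 < p)
    (hf : MemLp f (ENNReal.ofReal p)) : ∫⁻ x, ‖f x‖ₑ ^ p ≠ ⊤ := by
  have := hf.2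
  rw [eLpNorm_lt_top_iff_lintegral_rpow_enorm_lt_top (by simpa using hp) (by simp),
    ENNReal.toReal_ofReal hp.le] at this
  exact this.ne

theorem HasPosMaxBound.exists_majorant (hC : HasPosMaxBound μ E p q r C) (hp : 0 < p) (hq : 0 < q)
    {f g : Space d → ℂ} (hf : MemLp f (ENNReal.ofReal p)) (hg : MemLp g (ENNReal.ofReal q)) :
    ∃ W : Space d → ℝ≥0∞, Measurable W ∧
      (∀ x, posMax μ E (fun y => ‖f y‖ₑ) (fun y => ‖g y‖ₑ) x ≤ W x) ∧
      ∫⁻ x, W x ^ r ≤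
        C * (eLpNorm f (ENNReal.ofReal p) ^ r * eLpNorm g (ENNReal.ofReal q) ^ r) := by
  obtain ⟨W, h1, h2, h3⟩ := hC (fun x => ‖f x‖₊) (fun x => ‖g x‖₊)
    hf.aestronglyMeasurable.aemeasurable.nnnorm hg.aestronglyMeasurable.aemeasurable.nnnorm
    (lintegral_rpow_ne_top_of_memLp hp hf) (lintegral_rpow_ne_top_of_memLp hq hg)
  refine ⟨W, h1, h2, h3.trans_eq ?_⟩
  rw [eLpNorm_ofReal_eq _ hp, eLpNorm_ofReal_eq _ hq, ← ENNReal.rpow_mul, ← ENNReal.rpow_mul,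
    one_div_mul_eq_div, one_div_mul_eq_div]
  rfl

theorem HasPosMaxBound.ae_majorant_lt_top (hr : 0 < r) {f g : Space d → ℂ}
    (hf : MemLp f (ENNReal.ofReal p)) (hg : MemLp g (ENNReal.ofReal q)) {W : Space d → ℝ≥0∞}
    (hW : Measurable W) (h : ∫⁻ x, W x ^ r ≤
      C * (eLpNorm f (ENNReal.ofReal p) ^ r * eLpNorm g (ENNReal.ofReal q) ^ r)) :
    ∀ᵐ x, W x < ⊤ := by
  have h1 : ∫⁻ x, W x ^ r ≠ ⊤ := ne_top_of_le_ne_top (ENNReal.mul_ne_top ENNReal.coe_ne_top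
    (ENNReal.mul_ne_top (ENNReal.rpow_ne_top_of_nonneg hr.le hf.2.ne)
      (ENNReal.rpow_ne_top_of_nonneg hr.le hg.2.ne))) h
  filter_upwards [ae_lt_top (hW.pow_const r) h1] with x hx
  by_contra hcon
  rw [not_lt, top_le_iff] at hcon
  rw [hcon, ENNReal.top_rpow_of_pos hr] at hx
  exact hx.ne rfl

theorem integrable_of_posMax_lt_top {f g : Space d → ℂ} (hf : Measurable f) (hg : Measurable g)
    {x : Space d} (h : posMax μ E (fun y => ‖f y‖ₑ) (fun y => ‖g y‖ₑ) x < ⊤) {t : ℝ} (ht : t ∈ E) :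
    Integrable (fun w : Space d × Space d => f (x - t • w.1) * g (x - t • w.2)) μ := by
  refine ⟨(by fun_prop : Measurable _).aestronglyMeasurable, lt_of_le_of_lt ?_ h⟩
  simp only [enorm_mul]
  exact le_iSup₂ (f := fun t (_ : t ∈ E) =>
    ∫⁻ w : Space d × Space d, ‖f (x - t • w.1)‖ₑ * ‖g (x - t • w.2)‖ₑ ∂μ) t ht

/-- Based on `fg - f'g' = (f - f')g + f(g - g') - (f - f')(g - g')`, which involves only `f`, `g`
and the differences. The bound is uniform in `t ∈ E`. -/
theorem enorm_average_sub_le {f g f' g' : Space d → ℂ} (hf : Measurable f) (hg : Measurable g)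
    (hf' : Measurable f') (hg' : Measurable g') {x : Space d} {t : ℝ} (ht : t ∈ E)
    (hi : Integrable (fun w : Space d × Space d => f (x - t • w.1) * g (x - t • w.2)) μ)
    (hi' : Integrable (fun w : Space d × Space d => f' (x - t • w.1) * g' (x - t • w.2)) μ) :
    ‖bilinearAverage μ t f g x - bilinearAverage μ t f' g' x‖ₑ ≤
      posMax μ E (fun y => ‖(f - f') y‖ₑ) (fun y => ‖g y‖ₑ) x +
      posMax μ E (fun y => ‖f y‖ₑ) (fun y => ‖(g - g') y‖ₑ) x +
      posMax μ E (fun y => ‖(f - f') y‖ₑ) (fun y => ‖(g - g') y‖ₑ) x := by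
  unfold bilinearAverage
  rw [← integral_sub hi hi']
  refine (enorm_integral_le_lintegral_enorm _).trans ?_
  have h1 : ∀ w : Space d × Space d, ‖f (x - t • w.1) * g (x - t • w.2) -
      f' (x - t • w.1) * g' (x - t • w.2)‖ₑ ≤
      ‖(f - f') (x - t • w.1)‖ₑ * ‖g (x - t • w.2)‖ₑ +
      ‖f (x - t • w.1)‖ₑ * ‖(g - g') (x - t • w.2)‖ₑ +
      ‖(f - f') (x - t • w.1)‖ₑ * ‖(g - g') (x - t • w.2)‖ₑ := by
    intro w
    rw [← enorm_mul, ← enorm_mul, ← enorm_mul]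
    refine le_trans (le_of_eq ?_) ((enorm_sub_le).trans
      (add_le_add (enorm_add_le _ _) le_rfl))
    congr 1
    simp only [Pi.sub_apply]
    ring
  refine (lintegral_mono h1).trans ?_
  have m1 : Measurable (f - f') := hf.sub hf'
  have m2 : Measurable (g - g') := hg.sub hg'
  rw [lintegral_add_left (by fun_prop), lintegral_add_left (by fun_prop)]
  have hle : ∀ F G : Space d → ℝ≥0∞,
      ∫⁻ w : Space d × Space d, F (x - t • w.1) * G (x - t • w.2) ∂μ ≤ posMax μ E F G x :=
    fun F G => le_iSup₂ (f := fun t (_ : t ∈ E) =>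
      ∫⁻ w : Space d × Space d, F (x - t • w.1) * G (x - t • w.2) ∂μ) t ht
  exact add_le_add (add_le_add (hle (fun y => ‖(f - f') y‖ₑ) fun y => ‖g y‖ₑ)
    (hle (fun y => ‖f y‖ₑ) fun y => ‖(g - g') y‖ₑ))
    (hle (fun y => ‖(f - f') y‖ₑ) fun y => ‖(g - g') y‖ₑ)

theorem maximalAverage_le_add {f g f' g' : Space d → ℂ} {x : Space d} {D : ℝ≥0∞}
    (h : ∀ t ∈ E, ‖bilinearAverage μ t f g x - bilinearAverage μ t f' g' x‖ₑ ≤ D) :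
    maximalAverage μ E f g x ≤ maximalAverage μ E f' g' x + D := by
  refine iSup₂_le fun t ht => ?_
  calc ‖bilinearAverage μ t f g x‖ₑ
      = ‖bilinearAverage μ t f' g' x +
          (bilinearAverage μ t f g x - bilinearAverage μ t f' g' x)‖ₑ := by rw [add_sub_cancel]
    _ ≤ _ := enorm_add_le _ _
    _ ≤ _ := add_le_add (le_iSup₂ (f := fun t (_ : t ∈ E) => ‖bilinearAverage μ t f' g' x‖ₑ) t ht)
        (h t ht)

theorem HasPosMaxBound.ae_tendsto_zero (hC : HasPosMaxBound μ E p q r C) (hp : 0 < p) (hq : 0 < q)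
    (hr : 0 < r) {F G : ℕ → Space d → ℂ} (hF : ∀ n, MemLp (F n) (ENNReal.ofReal p))
    (hG : ∀ n, MemLp (G n) (ENNReal.ofReal q)) {M ρ : ℝ≥0∞} (hM : M ≠ ⊤) (hρ : ρ < 1)
    (h : ∀ n, eLpNorm (F n) (ENNReal.ofReal p) ^ r * eLpNorm (G n) (ENNReal.ofReal q) ^ r ≤
      M * ρ ^ n) :
    ∀ᵐ x, Tendsto (fun n => posMax μ E (fun y => ‖F n y‖ₑ) (fun y => ‖G n y‖ₑ) x) atTop
      (𝓝 0) := by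
  choose W hWm hW hWi using fun n => hC.exists_majorant hp hq (hF n) (hG n)
  have key := ae_tendsto_zero_of_lintegral_rpow_le hWm hr (M := C * M)
    (ENNReal.mul_ne_top ENNReal.coe_ne_top hM) hρ fun n => (hWi n).trans (by
      rw [mul_assoc]
      exact mul_le_mul_right (h n) _)
  filter_upwards [key] with x hx
  exact tendsto_of_tendsto_of_tendsto_of_le_of_le tendsto_const_nhds hx (fun _ => bot_le)
    fun n => hW n x

theorem tendsto_maximalAverage {f g : Space d → ℂ} {F G : ℕ → Space d → ℂ} {x : Space d}
    {D : ℕ → ℝ≥0∞} (hU : maximalAverage μ E f g x ≠ ⊤) (hD : Tendsto D atTop (𝓝 0))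
    (h : ∀ n, ∀ t ∈ E, ‖bilinearAverage μ t f g x - bilinearAverage μ t (F n) (G n) x‖ₑ ≤ D n) :
    Tendsto (fun n => maximalAverage μ E (F n) (G n) x) atTop (𝓝 (maximalAverage μ E f g x)) := by
  refine tendsto_of_tendsto_of_tendsto_of_le_of_le
    (g := fun n => maximalAverage μ E f g x - D n)
    (h := fun n => maximalAverage μ E f g x + D n) ?_ ?_ (fun n => ?_) fun n => ?_
  · simpa using ENNReal.Tendsto.sub (tendsto_const_nhds (x := maximalAverage μ E f g x)) hD
      (.inl hU)
  · simpa using (tendsto_const_nhds (x := maximalAverage μ E f g x)).add hD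
  · exact tsub_le_iff_right.2 (maximalAverage_le_add (h n))
  · refine maximalAverage_le_add fun t ht => ?_
    rw [enorm_sub_rev]
    exact h n t ht

/-- The geometric rate makes the maximal errors converge almost everywhere without passing to a
subsequence. -/
theorem exists_approx_rpow {s : ℝ} (hr : 0 < r) {f : Space d → ℂ}
    (hf : MemLp f (ENNReal.ofReal s)) :
    ∃ F : ℕ → Space d → ℂ, (∀ n, Continuous (F n)) ∧ (∀ n, HasCompactSupport (F n)) ∧
      (∀ n, MemLp (F n) (ENNReal.ofReal s)) ∧
      ∀ n, eLpNorm (f - F n) (ENNReal.ofReal s) ^ r ≤ ((2 : ℝ≥0∞)⁻¹ ^ r) ^ n := by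
  have hε : ∀ n : ℕ, ((2 : ℝ≥0∞)⁻¹ ^ n) ≠ 0 := fun n => by simp
  choose F hFc hFe hF hFp using fun n =>
    hf.exists_hasCompactSupport_eLpNorm_sub_le ENNReal.ofReal_ne_top (hε n)
  refine ⟨F, hF, hFc, hFp, fun n => (ENNReal.rpow_le_rpow (hFe n) hr.le).trans_eq ?_⟩
  rw [← ENNReal.rpow_natCast, ← ENNReal.rpow_natCast, ← ENNReal.rpow_mul, ← ENNReal.rpow_mul,
    mul_comm]

/-- The maximal average of `L^p` and `L^q` functions is measurable. -/
theorem HasPosMaxBound.aemeasurable_maximalAverage [IsFiniteMeasure μ]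
    (hC : HasPosMaxBound μ E p q r C) (hp : 0 < p)
    (hq : 0 < q) (hr : 0 < r) {f g : Space d → ℂ} (hfm : Measurable f) (hgm : Measurable g)
    (hf : MemLp f (ENNReal.ofReal p)) (hg : MemLp g (ENNReal.ofReal q)) :
    AEMeasurable (maximalAverage μ E f g) := by
  obtain ⟨F, hF, hFc, hFp, hFr⟩ := exists_approx_rpow hr hf
  obtain ⟨G, hG, hGc, hGq, hGr⟩ := exists_approx_rpow hr hg
  have hρ : (2 : ℝ≥0∞)⁻¹ ^ r < 1 := ENNReal.rpow_lt_one (by simp) hr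
  generalize (2 : ℝ≥0∞)⁻¹ ^ r = ρ at hFr hGr hρ
  obtain ⟨W, hWm, hW, hWi⟩ := hC.exists_majorant hp hq hf hg
  have t1 := hC.ae_tendsto_zero hp hq hr (fun n => hf.sub (hFp n)) (fun _ => hg)
    (ENNReal.rpow_ne_top_of_nonneg hr.le hg.2.ne) hρ fun n =>
      (mul_le_mul_left (hFr n) _).trans_eq (mul_comm _ _)
  have t2 := hC.ae_tendsto_zero hp hq hr (fun _ => hf) (fun n => hg.sub (hGq n))
    (ENNReal.rpow_ne_top_of_nonneg hr.le hf.2.ne) hρ fun n => mul_le_mul_right (hGr n) _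
  have t3 := hC.ae_tendsto_zero hp hq hr (fun n => hf.sub (hFp n)) (fun n => hg.sub (hGq n))
    ENNReal.one_ne_top hρ fun n =>
      mul_le_mul' ((hFr n).trans (pow_le_one' hρ.le n)) (hGr n)
  refine aemeasurable_of_tendsto_metrizable_ae atTop
    (fun n => (measurable_maximalAverage (μ := μ) (E := E) (hF n) (hFc n) (hG n)
      (hGc n)).aemeasurable) ?_
  filter_upwards [t1, t2, t3, HasPosMaxBound.ae_majorant_lt_top hr hf hg hWm hWi]
    with x h1 h2 h3 hWx
  have hpos : posMax μ E (fun y => ‖f y‖ₑ) (fun y => ‖g y‖ₑ) x < ⊤ := (hW x).trans_lt hWx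
  refine tendsto_maximalAverage ((maximalAverage_le_posMax μ E f g x).trans_lt hpos).ne
    (by simpa only [add_zero] using (h1.add h2).add h3) fun n t ht => ?_
  exact enorm_average_sub_le hfm hgm (hF n).measurable (hG n).measurable ht
    (integrable_of_posMax_lt_top hfm hgm hpos ht)
    (integrable_average (hF n) (hFc n) (hG n) (hGc n) t x)

/-- Changing two functions on null sets does not affect the products that are averaged, for almost
every `x` and all times simultaneously. -/
theorem HasPosMaxBound.ae_forall_ae_eq (hC : HasPosMaxBound μ E p q r C) (hp : 0 < p) (hq : 0 < q)
    (hr : 0 < r) {f g f' g' : Space d → ℂ} (hf' : Measurable f') (hg' : Measurable g')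
    (hf : MemLp f' (ENNReal.ofReal p)) (hg : MemLp g' (ENNReal.ofReal q)) (hff : f =ᵐ[volume] f')
    (hgg : g =ᵐ[volume] g') :
    ∀ᵐ x : Space d, ∀ t ∈ E, (fun w : Space d × Space d => f (x - t • w.1) * g (x - t • w.2))
      =ᵐ[μ] fun w => f' (x - t • w.1) * g' (x - t • w.2) := by
  obtain ⟨N, hNsub, hNm, hN0⟩ := exists_measurable_superset_of_null
    (s := {x | f x ≠ f' x} ∪ {x | g x ≠ g' x}) (measure_union_null hff hgg)
  have hfN : ∀ x, x ∉ N → f x = f' x := fun x hx => by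
    by_contra h
    exact hx (hNsub (Or.inl h))
  have hgN : ∀ x, x ∉ N → g x = g' x := fun x hx => by
    by_contra h
    exact hx (hNsub (Or.inr h))
  have hNae : ∀ᵐ x, x ∉ N := measure_eq_zero_iff_ae_notMem.1 hN0
  -- The bound is applied to the indicator of the exceptional null set, paired with `|g'| + φ` and
  -- with `|f'| + φ`. One factor has norm zero, so both majorants vanish almost everywhere. The
  -- added `φ` excludes that both points lie in `N`; if just one does, the function at the other
  -- point vanishes.
  set φ : Space d → ℝ≥0 := N.indicator 1 with hφ
  have hφm : Measurable φ := measurable_one.indicator hNm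
  have hφ0 : ∀ s : ℝ, 0 < s → ∫⁻ x, (φ x : ℝ≥0∞) ^ s = 0 := by
    intro s hs
    rw [lintegral_eq_zero_iff (by fun_prop)]
    filter_upwards [hNae] with x hx
    simp [hφ, hx, hs]
  have hsum : ∀ (h : Space d → ℂ) (s : ℝ), 0 < s → MemLp h (ENNReal.ofReal s) →
      ∫⁻ x, ((‖h x‖₊ + φ x : ℝ≥0) : ℝ≥0∞) ^ s ≠ ⊤ := by
    intro h s hs hh
    refine ne_of_eq_of_ne (lintegral_congr_ae ?_) (lintegral_rpow_ne_top_of_memLp hs hh)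
    filter_upwards [hNae] with x hx
    simp [hφ, hx, enorm_eq_nnnorm]
  obtain ⟨W1, hW1m, hW1, hW1i⟩ := hC φ (fun x => ‖g' x‖₊ + φ x) hφm.aemeasurable
    (by fun_prop) (by rw [hφ0 p hp]; simp) (hsum g' q hq hg)
  obtain ⟨W2, hW2m, hW2, hW2i⟩ := hC (fun x => ‖f' x‖₊ + φ x) φ
    (by fun_prop) hφm.aemeasurable (hsum f' p hp hf) (by rw [hφ0 q hq]; simp)
  rw [hφ0 p hp, ENNReal.zero_rpow_of_pos (by positivity), zero_mul, mul_zero, nonpos_iff_eq_zero,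
    lintegral_eq_zero_iff (hW1m.pow_const r)] at hW1i
  rw [hφ0 q hq, ENNReal.zero_rpow_of_pos (by positivity), mul_zero, mul_zero, nonpos_iff_eq_zero,
    lintegral_eq_zero_iff (hW2m.pow_const r)] at hW2i
  filter_upwards [hW1i, hW2i] with x h1 h2 t ht
  have z1 : W1 x = 0 := by simpa [hr, hr.not_gt] using h1
  have z2 : W2 x = 0 := by simpa [hr, hr.not_gt] using h2
  have i1 : ∫⁻ w : Space d × Space d, (φ (x - t • w.1) : ℝ≥0∞) *
      ((‖g' (x - t • w.2)‖₊ + φ (x - t • w.2) : ℝ≥0) : ℝ≥0∞) ∂μ = 0 :=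
    le_antisymm ((le_iSup₂ (f := fun t (_ : t ∈ E) => ∫⁻ w : Space d × Space d,
      (φ (x - t • w.1) : ℝ≥0∞) * ((‖g' (x - t • w.2)‖₊ + φ (x - t • w.2) : ℝ≥0) : ℝ≥0∞) ∂μ)
      t ht).trans ((hW1 x).trans z1.le)) bot_le
  have i2 : ∫⁻ w : Space d × Space d, ((‖f' (x - t • w.1)‖₊ + φ (x - t • w.1) : ℝ≥0) : ℝ≥0∞) *
      (φ (x - t • w.2) : ℝ≥0∞) ∂μ = 0 :=
    le_antisymm ((le_iSup₂ (f := fun t (_ : t ∈ E) => ∫⁻ w : Space d × Space d,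
      ((‖f' (x - t • w.1)‖₊ + φ (x - t • w.1) : ℝ≥0) : ℝ≥0∞) * (φ (x - t • w.2) : ℝ≥0∞) ∂μ)
      t ht).trans ((hW2 x).trans z2.le)) bot_le
  rw [lintegral_eq_zero_iff (by fun_prop)] at i1 i2
  filter_upwards [i1, i2] with w k1 k2
  by_cases c1 : x - t • w.1 ∈ N <;> by_cases c2 : x - t • w.2 ∈ N
  · simp [hφ, c1, c2] at k1
  · have hg0 : g' (x - t • w.2) = 0 := by simpa [hφ, c1, c2] using k1
    rw [hgN _ c2, hg0, mul_zero, mul_zero]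
  · have hf0 : f' (x - t • w.1) = 0 := by simpa [hφ, c1, c2] using k2
    rw [hfN _ c1, hf0, zero_mul, zero_mul]
  · rw [hfN _ c1, hgN _ c2]

theorem HasPosMaxBound.isBoundedMaximal [IsFiniteMeasure μ] (hC : HasPosMaxBound μ E p q r C)
    (hp : 0 < p) (hq : 0 < q) (hr : 0 < r) : IsBoundedMaximal μ E p q r := by
  have key : ∀ f g : Space d → ℂ, MemLp f (ENNReal.ofReal p) volume →
      MemLp g (ENNReal.ofReal q) volume →
      (∀ᵐ x : Space d, ∀ t ∈ E,
        Integrable (fun w : Space d × Space d => f (x - t • w.1) * g (x - t • w.2)) μ) ∧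
      MemLp (maximalAverage μ E f g) (ENNReal.ofReal r) volume ∧
      eLpNorm (maximalAverage μ E f g) (ENNReal.ofReal r) volume ≤
        ((C ^ (1 / r) : ℝ≥0) : ℝ≥0∞) * eLpNorm f (ENNReal.ofReal p) volume *
          eLpNorm g (ENNReal.ofReal q) volume := by
    intro f g hf hg
    set f' := hf.aestronglyMeasurable.mk f with hf'
    set g' := hg.aestronglyMeasurable.mk g with hg'
    have hff : f =ᵐ[volume] f' := hf.aestronglyMeasurable.ae_eq_mk
    have hgg : g =ᵐ[volume] g' := hg.aestronglyMeasurable.ae_eq_mk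
    have hfm : Measurable f' := hf.aestronglyMeasurable.stronglyMeasurable_mk.measurable
    have hgm : Measurable g' := hg.aestronglyMeasurable.stronglyMeasurable_mk.measurable
    have hfp : MemLp f' (ENNReal.ofReal p) volume := (memLp_congr_ae hff).1 hf
    have hgq : MemLp g' (ENNReal.ofReal q) volume := (memLp_congr_ae hgg).1 hg
    have hae := hC.ae_forall_ae_eq hp hq hr hfm hgm hfp hgq hff hgg
    obtain ⟨W, hWm, hW, hWi⟩ := hC.exists_majorant hp hq hfp hgq
    have hmax : maximalAverage μ E f g =ᵐ[volume] maximalAverage μ E f' g' := by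
      filter_upwards [hae] with x hx
      unfold maximalAverage bilinearAverage
      congr 1
      ext t
      congr 1
      ext ht
      rw [integral_congr_ae (hx t ht)]
    have hnorm : eLpNorm (maximalAverage μ E f g) (ENNReal.ofReal r) volume ≤
        ((C ^ (1 / r) : ℝ≥0) : ℝ≥0∞) * eLpNorm f (ENNReal.ofReal p) volume *
          eLpNorm g (ENNReal.ofReal q) volume := by
      rw [eLpNorm_congr_ae hmax, eLpNorm_congr_ae hff, eLpNorm_congr_ae hgg,
        eLpNorm_ofReal_eq _ hr]
      simp only [enorm_eq_self]
      calc (∫⁻ x, maximalAverage μ E f' g' x ^ r) ^ (1 / r)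
          ≤ (∫⁻ x, W x ^ r) ^ (1 / r) := by
            gcongr with x
            exact (maximalAverage_le_posMax μ E f' g' x).trans (hW x)
        _ ≤ (C * (eLpNorm f' (ENNReal.ofReal p) ^ r * eLpNorm g' (ENNReal.ofReal q) ^ r)) ^
              (1 / r) := by gcongr
        _ = _ := by
            have hr' : 0 ≤ 1 / r := by positivity
            rw [ENNReal.mul_rpow_of_nonneg _ _ hr', ENNReal.mul_rpow_of_nonneg _ _ hr',
              ← ENNReal.rpow_mul, ← ENNReal.rpow_mul, mul_one_div_cancel hr.ne', ENNReal.rpow_one,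
              ENNReal.rpow_one, ENNReal.coe_rpow_of_nonneg _ hr', mul_assoc]
    refine ⟨?_, ⟨?_, hnorm.trans_lt ?_⟩, hnorm⟩
    · filter_upwards [hae, HasPosMaxBound.ae_majorant_lt_top hr hfp hgq hWm hWi] with x hx hWx t ht
      exact (integrable_of_posMax_lt_top hfm hgm ((hW x).trans_lt hWx) ht).congr (hx t ht).symm
    · exact ((hC.aemeasurable_maximalAverage hp hq hr hfm hgm hfp hgq).congr
        hmax.symm).aestronglyMeasurable
    · exact ENNReal.mul_lt_top (ENNReal.mul_lt_top ENNReal.coe_lt_top hf.2) hg.2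
  refine ⟨C ^ (1 / r), fun f g hf hg => ?_, key⟩
  have heq : maximalMultiplier (fourierMeasure μ) E f g = maximalAverage μ E f g := by
    ext x
    unfold maximalMultiplier maximalAverage
    simp only [bilinearMultiplier_eq_bilinearAverage μ hf hg]
  rw [heq]
  exact (key f g (hf.1.continuous.memLp_of_hasCompactSupport hf.2)
    (hg.1.continuous.memLp_of_hasCompactSupport hg.2)).2

end

/-! ### Conclusion -/

/-- The bound for `1 ≤ p, q ≤ 2` under the single condition on `1 / p + 1 / q`. -/
theorem isBoundedMaximal_of_admissible (hd : 1 ≤ d)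
    {μ : Measure (Space d × Space d)} [IsFiniteMeasure μ] (hμ : CompactlySupported μ)
    {E : Set ℝ} (hE : E ⊆ Set.Icc 1 2) {β : ℝ} (hβ : upperMinkowskiDim E = (β : EReal))
    {a : ℝ} (ha : IsAdmissible a (fourierMeasure μ)) {p q r : ℝ} (hp1 : 1 ≤ p) (hp2 : p ≤ 2)
    (hq1 : 1 ≤ q) (hq2 : q ≤ 2) (hpq : 1 / p + 1 / q < 1 / 2 + (2 * a - β) / (2 * d))
    (hr : (1 / p + 1 / q)⁻¹ ≤ r) (hr2 : r ≤ 2) : IsBoundedMaximal μ E p q r := by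
  have hp : 0 < p := by linarith
  have hq : 0 < q := by linarith
  have hs : 0 < 1 / p + 1 / q := by positivity
  have hr0 : 0 < r := lt_of_lt_of_le (inv_pos.2 hs) hr
  have hpqr : 1 ≤ r / p + r / q := by
    rw [inv_le_iff_one_le_mul₀ hs] at hr
    calc (1 : ℝ) ≤ r * (1 / p + 1 / q) := hr
      _ = _ := by ring
  obtain ⟨K, hK⟩ := exists_lintegral_maximalMultiplier_sq_le hd hμ hE hβ ha hp1 hp2 hq1 hq2 hpq
  obtain ⟨C, hC⟩ := exists_measurable_posMax_rpow_le hd hμ hE hp hq hr0 hr2 hpqr (K := K)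
    fun f g hf hg => by
      have h := hK f g hf hg
      unfold maximalMultiplier at h
      simp only [bilinearMultiplier_eq_bilinearAverage μ hf hg] at h
      exact h
  exact HasPosMaxBound.isBoundedMaximal hC hp hq hr0

end BilinearMaximal

end

theorem proposition6p5 (d : ℕ) (hd : 1 ≤ d)
    (μ : MeasureTheory.Measure (BilinearMaximal.Space d × BilinearMaximal.Space d))
    [MeasureTheory.IsFiniteMeasure μ] (hμ : BilinearMaximal.CompactlySupported μ)
    (E : Set ℝ) (hE : E.Nonempty) (hE' : E ⊆ Set.Icc 1 2)
    (β : ℝ) (hβ : BilinearMaximal.upperMinkowskiDim E = (β : EReal))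
    (a : ℝ) (ha : BilinearMaximal.IsAdmissible a (BilinearMaximal.fourierMeasure μ))
    (haβ : (d : ℝ) + β < 2 * a) :
    (a ≤ d + β / 2 →
      ∀ p q r : ℝ, 2 * d / (2 * a - β) < p → p ≤ 2 → 2 * d / (2 * a - β) < q → q ≤ 2 →
        1 / p + 1 / q < 1 / 2 + (2 * a - β) / (2 * d) →
        (1 / p + 1 / q)⁻¹ ≤ r → r ≤ 2 →
        BilinearMaximal.IsBoundedMaximal μ E p q r) ∧
    (d + β / 2 < a →
      ∀ p q r : ℝ, 1 < p → p ≤ 2 → 1 < q → q ≤ 2 →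
        1 / p + 1 / q < 3 / 2 →
        (1 / p + 1 / q)⁻¹ ≤ r → r ≤ 2 →
        BilinearMaximal.IsBoundedMaximal μ E p q r) := by
  have hd0 : (0 : ℝ) < d := by exact_mod_cast hd
  have hpos : 0 < 2 * a - β := by linarith
  constructor
  · intro haβ' p q r hp hp2 hq hq2 hpq hr hr2
    -- Equivalent to `a ≤ d + β/2`. The lower bounds on `p` and `q` enter only through `p, q ≥ 1`.
    have h1 : 1 ≤ 2 * d / (2 * a - β) := by
      rw [le_div_iff₀ hpos]
      linarith
    exact BilinearMaximal.isBoundedMaximal_of_admissible hd hμ hE' hβ ha (h1.trans hp.le) hp2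
      (h1.trans hq.le) hq2 hpq hr hr2
  · intro haβ' p q r hp hp2 hq hq2 hpq hr hr2
    -- For `a > d + β/2` the general threshold is at least `1/2 + 1 = 3/2`.
    have h1 : 1 ≤ (2 * a - β) / (2 * d) := by
      rw [le_div_iff₀ (by positivity)]
      linarith
    exact BilinearMaximal.isBoundedMaximal_of_admissible hd hμ hE' hβ ha hp.le hp2 hq.le hq2
      (by linarith) hr hr2
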